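/- **Language.** Fix a set $\mathcal A$ of atomic types and a set of variables. Types are $A,B ::= X \mid I \mid \mathbf A \mid A+B \mid A\otimes B \mid \mu X.A$ with $\mathbf A\in\mathcal A$ (type variables up to renaming of bound ones), and $\mathbf{bit}=I+I$. A variable context $\Gamma=x_1:A_1,\dots,x_n:A_n$ is a finite assignment of closed types to distinct variables, irrespective of order; in "$\Gamma,x:A$" the variable $x$ does not occur in $\Gamma$. Values are $v,w::= * \mid \mathbf{left}_{A,B}v\mid\mathbf{right}_{A,B}v\mid(v,w)\mid\mathbf{fold}_{\mu X.A}v$, typed by $*:I$; $\mathbf{left}_{A,B}v:A+B$ if $v:A$; $\mathbf{right}_{A,B}v:A+B$ if $v:B$; $(v,w):A\otimes B$ if $v:A$, $w:B$; $\mathbf{fold}_{\mu X.A}v:\mu X.A$ if $v:A[\mu X.A/X]$. Term judgements $\langle\Gamma\rangle M\langle\Sigma\rangle$ are generated by * $\langle\Gamma\rangle\,\mathbf{new\ unit}\ u\,\langle\Gamma,u:I\rangle$; $\langle\Gamma,x:A\rangle\,\mathbf{discard}\ x\,\langle\Gamma\rangle$; $\langle\Gamma\rangle\,\mathbf{skip}\,\langle\Gamma\rangle$;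 * $\langle\Gamma\rangle M;N\langle\Sigma\rangle$ if $\langle\Gamma\rangle M\langle\Gamma'\rangle$ and $\langle\Gamma'\rangle N\langle\Sigma\rangle$; * $\langle\Gamma,b:\mathbf{bit}\rangle\,\mathbf{while}\ b\ \mathbf{do}\ M\,\langle\Gamma,b:\mathbf{bit}\rangle$ if $\langle\Gamma,b:\mathbf{bit}\rangle M\langle\Gamma,b:\mathbf{bit}\rangle$; * $\langle\Gamma,x:A\rangle\,y=\mathbf{left}_{A,B}x\,\langle\Gamma,y:A+B\rangle$; $\langle\Gamma,x:B\rangle\,y=\mathbf{right}_{A,B}x\,\langle\Gamma,y:A+B\rangle$; * $\langle\Gamma,y:A+B\rangle\,\mathbf{case}\ y\ \mathbf{of}\ \{\mathbf{left}\ x_1\to M_1\mid\mathbf{right}\ x_2\to M_2\}\,\langle\Sigma\rangle$ if $\langle\Gamma,x_1:A\rangle M_1\langle\Sigma\rangle$ and $\langle\Gamma,x_2:B\rangle M_2\langle\Sigma\rangle$; * $\langle\Gamma,x_1:A,x_2:B\rangle\,x=(x_1,x_2)\,\langle\Gamma,x:A\otimes B\rangle$; $\langle\Gamma,x:A\otimes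 B\rangle\,(x_1,x_2)=x\,\langle\Gamma,x_1:A,x_2:B\rangle$; * $\langle\Gamma,x:A[\mu X.A/X]\rangle\,y=\mathbf{fold}_{\mu X.A}x\,\langle\Gamma,y:\mu X.A\rangle$; $\langle\Gamma,x:\mu X.A\rangle\,y=\mathbf{unfold}\ x\,\langle\Gamma,y:A[\mu X.A/X]\rangle$. A configuration $(M\mid V)$ is a term with a value assignment $V=\{x_1=v_1,\dots,x_n=v_n\}$. It is well-formed, $\Gamma;\Sigma\vdash(M\mid V)$, if $\langle\Gamma\rangle M\langle\Sigma\rangle$ and $V$ has the same variables as $\Gamma$ and assigns to each a value of its type. **Reduction.** $\leadsto$ is the least relation with: $(\mathbf{new\ unit}\ u\mid V)\leadsto(\mathbf{skip}\mid V,u=*)$; $(\mathbf{discard}\ x\mid V,x=v)\leadsto(\mathbf{skip}\mid V)$; $(\mathbf{skip};P\mid V)\leadsto(P\mid V)$; $(P;Q\mid V)\leadsto(P';Q\mid V')$ if $(P\mid V)\leadsto(P'\mid V')$; $(\mathbf{while}\ b\ \mathbf{do}\ M\mid V,b=v)\leadsto(\mathbf{if}\ b\ \mathbf{then}\ \{M;\mathbf{while}\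 b\ \mathbf{do}\ M\}\mid V,b=v)$, where $\mathbf{if}\ b\ \mathbf{then}\ \{N\}$ is $\mathbf{case}\ b\ \mathbf{of}\ \{\mathbf{left}\ u\to b=\mathbf{left}_{I,I}\,u\mid\mathbf{right}\ u\to b=\mathbf{right}_{I,I}\,u;N\}$ for any variable $u$ not occurring in $V$; $(y=\mathbf{left}_{A,B}x\mid V,x=v)\leadsto(\mathbf{skip}\mid V,y=\mathbf{left}_{A,B}v)$ and likewise for $\mathbf{right}$; $(\mathbf{case}\ y\ \mathbf{of}\ \{\mathbf{left}\ x_1\to M_1\mid\mathbf{right}\ x_2\to M_2\}\mid V,y=\mathbf{left}_{A,B}\,v)\leadsto(M_1\mid V,x_1=v)$ and likewise for $\mathbf{right}$; $(x=(x_1,x_2)\mid V,x_1=v_1,x_2=v_2)\leadsto(\mathbf{skip}\mid V,x=(v_1,v_2))$; $((x_1,x_2)=x\mid V,x=(v_1,v_2))\leadsto(\mathbf{skip}\mid V,x_1=v_1,x_2=v_2)$; $(y=\mathbf{fold}_{\mu X.A}\,x\mid V,x=v)\leadsto(\mathbf{skip}\mid V,y=\mathbf{fold}_{\mu X.A}\,v)$;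 $(y=\mathbf{unfold}\ x\mid V,x=\mathbf{fold}_{\mu X.A}\,v)\leadsto(\mathbf{skip}\mid V,y=v)$. **Models.** A model is a symmetric monoidal category $(\mathbf C,\otimes,I)$ with an initial object and binary coproducts over which $\otimes$ distributes; an object $\mathbf A$ with a map $\diamond_{\mathbf A}:\mathbf A\to I$ for each atomic type; such that $\mathbf C$ has colimits of $\omega$-chains and $\otimes$ preserves them, and $\mathbf C$ is enriched in pointed dcpos and strict Scott-continuous maps, with $\otimes$ and copairing Scott-continuous on hom-sets. **Interpretation.** For $T:\mathbf D\times\mathbf E\to\mathbf E$, a parameterised initial algebra is a functor $T^\dagger:\mathbf D\to\mathbf E$ with a natural isomorphism $\tau:T\circ\langle\mathrm{Id},T^\dagger\rangle\cong T^\dagger$ such that each $(T^\dagger X,\tau_X)$ is an initial $T(X,-)$-algebra. A type with $n$ free variables is interpreted as a functor $\mathbf C^n\to\mathbf C$: type variables by projections, $I$ and atomic types by constants, $+$ and $\otimes$ pointwise, and $\mu X.A$ by $⟦A⟧^\dagger$. The same recursion in the slice category $\mathbf C/I$, with $(I,\mathrm{id})$, $(\mathbf A,\diamond_{\mathbf A})$,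 $(A,\diamond_A)+(B,\diamond_B)=(A+B,[\diamond_A,\diamond_B])$, $(A,\diamond_A)\otimes(B,\diamond_B)=(A\otimes B,\lambda_I\circ(\diamond_A\otimes\diamond_B))$ and parameterised initial algebras lying over those in $\mathbf C$, gives each closed type $A$ a discarding map $\diamond_A:⟦A⟧\to I$. The parameterised initial algebras are chosen so that $⟦A[\mu X.A/X]⟧=⟦A⟧(⟦\mu X.A⟧)$, and $\mathrm{fold}:⟦A[\mu X.A/X]⟧\cong⟦\mu X.A⟧:\mathrm{unfold}$ is $\tau$ and its inverse. A context is interpreted by $⟦\Gamma⟧=⟦A_1⟧\otimes\cdots\otimes⟦A_n⟧$ (in a fixed order of the variables, up to the canonical symmetry isomorphisms). Terms are interpreted as morphisms $⟦\Gamma⟧\to⟦\Sigma⟧$: $\mathbf{skip}$ as the identity, $M;N$ as composition, $\mathbf{new\ unit}$ as $⟦\Gamma⟧\cong⟦\Gamma⟧\otimes I$, $\mathbf{discard}\ x$ as $\mathrm{id}\otimes\diamond_A$ followed by $⟦\Gamma⟧\otimes I\cong⟦\Gamma⟧$, $\mathbf{left},\mathbf{right},\mathbf{fold},\mathbf{unfold}$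 as $\mathrm{id}_{⟦\Gamma⟧}$ tensored with the map of that name, pairing and unpairing as identities (associativity), $\mathbf{case}$ as $[⟦M_1⟧,⟦M_2⟧]\circ d$ with $d:X\otimes(Y+Z)\cong(X\otimes Y)+(X\otimes Z)$, and $\mathbf{while}\ b\ \mathbf{do}\ M$ as $\bigvee_i W^i(\bot)$ where $W(g)=[\mathrm{id}\otimes\mathrm{left},\ g\circ⟦M⟧\circ(\mathrm{id}\otimes\mathrm{right})]\circ d$. Values $v:A$ are interpreted as maps $I\to⟦A⟧$ by $⟦*⟧=\mathrm{id}_I$, composition with $\mathrm{left}$, $\mathrm{right}$, $\mathrm{fold}$, and $⟦(v,w)⟧=(⟦v⟧\otimes⟦w⟧)\circ\lambda_I^{-1}$; $⟦V⟧:I\cong I^{\otimes n}\to⟦\Gamma⟧$ is the tensor of the values; and $⟦(M\mid V)⟧=⟦M⟧\circ⟦V⟧:I\to⟦\Sigma⟧$. **Theorem (Soundness).** In any model, if $\Gamma;\Sigma\vdash\mathcal C$ and $\mathcal C\leadsto\mathcal D$, then $\Gamma';\Sigma\vdash\mathcal D$ for some context $\Gamma'$, and $⟦\mathcal C⟧=⟦\mathcal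 D⟧$ as morphisms $I\to⟦\Sigma⟧$. -/

import Mathlib

open CategoryTheory Limits MonoidalCategory
open scoped CategoryTheory.Prod

namespace AffineLang

section InitialAlgebras

universe v₁ u₁ v₂ u₂ v₃ u₃

variable {A' : Type u₃} [Category.{v₃} A'] {A : Type u₁} [Category.{v₁} A]
  {B : Type u₂} [Category.{v₂} B]

/-- A functor is `ω`-cocontinuous if it preserves colimits of `ω`-chains. -/
abbrev OmegaCocontinuous (F : A ⥤ B) : Prop := PreservesColimitsOfShape ℕ F

/-- A parameterised initial algebra for `T : A × B ⥤ B`: a functor `T† : A ⥤ B` with a natural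
isomorphism `τ : T ∘ ⟨Id, T†⟩ ≅ T†`, such that `(T† X, τ_X)` is an initial `T(X, -)`-algebra
for every `X`. -/
structure ParamInitialAlgebra (T : A × B ⥤ B) where
  functor : A ⥤ B
  iso : (𝟭 A).prod' functor ⋙ T ≅ functor
  isInitial : ∀ X : A, IsInitial
    (⟨functor.obj X, iso.hom.app X⟩ : Endofunctor.Algebra ((Functor.curry.obj T).obj X))

/-- The product of two cocones. -/
def prodCocone {D : ℕ ⥤ A} {E : ℕ ⥤ B} (c : Cocone D) (e : Cocone E) : Cocone (D.prod' E) where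
  pt := (c.pt, e.pt)
  ι :=
    { app := fun n => (c.ι.app n ×ₘ e.ι.app n : (D.obj n, E.obj n) ⟶ (c.pt, e.pt))
      naturality := fun _ _ f => Prod.hom_ext (c.ι.naturality f) (e.ι.naturality f) }

/-- The product of two colimiting cocones is colimiting. -/
def prodIsColimit {D : ℕ ⥤ A} {E : ℕ ⥤ B} {c : Cocone D} {e : Cocone E}
    (hc : IsColimit c) (he : IsColimit e) : IsColimit (prodCocone c e) where
  desc s := (hc.desc ((CategoryTheory.Prod.fst A B).mapCocone s), he.desc ((CategoryTheory.Prod.snd A B).mapCocone s))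
  fac s n := Prod.hom_ext (hc.fac ((CategoryTheory.Prod.fst A B).mapCocone s) n)
    (he.fac ((CategoryTheory.Prod.snd A B).mapCocone s) n)
  uniq s m hm := Prod.hom_ext
    (hc.uniq ((CategoryTheory.Prod.fst A B).mapCocone s) m.1 (fun n => congrArg (fun f => f.1) (hm n)))
    (he.uniq ((CategoryTheory.Prod.snd A B).mapCocone s) m.2 (fun n => congrArg (fun f => f.2) (hm n)))

theorem curry_obj_cocontinuous (T : A × B ⥤ B) (hT : OmegaCocontinuous T) (X : A) :
    OmegaCocontinuous ((Functor.curry.obj T).obj X) := by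
  refine ⟨fun {K} => ⟨fun {c} hc => ?_⟩⟩
  have hc' := prodIsColimit (isColimitConstCocone ℕ X) hc
  exact ⟨IsColimit.ofIsoColimit (isColimitOfPreserves T hc') (Cocone.ext (Iso.refl _) (fun n => by
    exact Category.comp_id _))⟩

theorem map_comp_map (T : A × B ⥤ B) {X X' X'' : A} {Y Y' Y'' : B} (f : X ⟶ X') (f' : X' ⟶ X'')
    (g : Y ⟶ Y') (g' : Y' ⟶ Y'') :
    T.map (f ×ₘ g) ≫ T.map (f' ×ₘ g') = T.map ((f ≫ f') ×ₘ (g ≫ g')) :=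
  (T.map_comp _ _).symm

variable [HasInitial B]

section Chain

variable (F : B ⥤ B)

/-- The objects `Fⁿ ∅` of the initial chain of an endofunctor. -/
noncomputable def chainObj : ℕ → B
  | 0 => ⊥_ B
  | n + 1 => F.obj (chainObj n)

/-- The connecting maps of the initial chain. -/
noncomputable def chainMap : ∀ n, chainObj F n ⟶ chainObj F (n + 1)
  | 0 => initial.to _
  | n + 1 => F.map (chainMap n)

/-- The initial chain `∅ ⟶ F ∅ ⟶ F (F ∅) ⟶ ⋯`. -/
noncomputable def chain : ℕ ⥤ B := Functor.ofSequence (chainMap F)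

/-- The maps from the initial chain to the carrier of an algebra. -/
noncomputable def chainTo (Y : Endofunctor.Algebra F) : ∀ n, chainObj F n ⟶ Y.a
  | 0 => initial.to _
  | n + 1 => F.map (chainTo Y n) ≫ Y.str

theorem chainMap_to (Y : Endofunctor.Algebra F) :
    ∀ n, chainMap F n ≫ chainTo F Y (n + 1) = chainTo F Y n
  | 0 => initialIsInitial.hom_ext _ _
  | n + 1 => by
      change F.map (chainMap F n) ≫ F.map (chainTo F Y (n + 1)) ≫ Y.str = F.map _ ≫ Y.str
      rw [← F.map_comp_assoc, chainMap_to Y n]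

/-- The cocone over the initial chain given by an algebra. -/
noncomputable def chainCocone (Y : Endofunctor.Algebra F) : Cocone (chain F) where
  pt := Y.a
  ι := NatTrans.ofSequence (G := (Functor.const ℕ).obj Y.a) (chainTo F Y) (fun n => by
    have e : (chain F).map (homOfLE (Nat.le_add_right n 1)) = chainMap F n :=
      Functor.ofSequence_map_homOfLE_succ _ _
    rw [e]
    exact (chainMap_to F Y n).trans (Category.comp_id _).symm)

variable [HasColimitsOfShape ℕ B]

/-- The map from the colimit of the initial chain to the carrier of an algebra. -/
noncomputable def chainDesc (Y : Endofunctor.Algebra F) : colimit (chain F) ⟶ Y.a :=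
  colimit.desc (chain F) (chainCocone F Y)

theorem ι_chainDesc (Y : Endofunctor.Algebra F) (n : ℕ) :
    colimit.ι (chain F) n ≫ chainDesc F Y = chainTo F Y n :=
  colimit.ι_desc _ _

/-- The cocone over the image of the initial chain, given by the shifted injections. -/
noncomputable def chainShift : Cocone (chain F ⋙ F) where
  pt := colimit (chain F)
  ι := NatTrans.ofSequence (F := chain F ⋙ F)
    (G := (Functor.const ℕ).obj (colimit (chain F)))
    (fun n => colimit.ι (chain F) (n + 1)) (fun n => by
      have h := colimit.w (chain F) (homOfLE (Nat.le_add_right (n + 1) 1))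
      have e : (chain F).map (homOfLE (Nat.le_add_right (n + 1) 1)) = F.map (chainMap F n) :=
        Functor.ofSequence_map_homOfLE_succ _ _
      have e' : (chain F).map (homOfLE (Nat.le_add_right n 1)) = chainMap F n :=
        Functor.ofSequence_map_homOfLE_succ _ _
      rw [e] at h
      rw [Functor.comp_map, e']
      exact h.trans (Category.comp_id _).symm)

/-- An `ω`-cocontinuous endofunctor has an initial algebra. -/
theorem exists_initialAlgebra (h : OmegaCocontinuous F) :
    ∃ X : Endofunctor.Algebra F, Nonempty (IsInitial X) := by
  have hF := isColimitOfPreserves F (colimit.isColimit (chain F))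
  obtain ⟨str, key⟩ : ∃ str : F.obj (colimit (chain F)) ⟶ colimit (chain F),
      ∀ n, F.map (colimit.ι (chain F) n) ≫ str = colimit.ι (chain F) (n + 1) :=
    ⟨hF.desc (chainShift F), fun n => hF.fac (chainShift F) n⟩
  have e1 : ∀ Y n, colimit.ι (chain F) n ≫ chainDesc F Y = chainTo F Y n := ι_chainDesc F
  refine ⟨⟨colimit (chain F), str⟩, ⟨?_⟩⟩
  refine IsInitial.ofUniqueHom (fun Y => ⟨chainDesc F Y, ?_⟩) ?_
  · refine hF.hom_ext (fun n => ?_)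
    have l : (F.map (colimit.ι (chain F) n) ≫ F.map (chainDesc F Y)) ≫ Y.str =
        chainTo F Y (n + 1) := by
      rw [← F.map_comp, e1]; rfl
    have r : (F.map (colimit.ι (chain F) n) ≫ str) ≫ chainDesc F Y =
        chainTo F Y (n + 1) := by
      rw [key]; exact e1 Y (n + 1)
    exact (Category.assoc _ _ _).symm.trans (l.trans (r.symm.trans (Category.assoc _ _ _)))
  · intro Y m
    obtain ⟨g, hg⟩ : ∃ g : colimit (chain F) ⟶ Y.a, g = m.f := ⟨m.f, rfl⟩
    have hm : F.map g ≫ Y.str = str ≫ g := by rw [hg]; exact m.h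
    have main : ∀ n, colimit.ι (chain F) n ≫ g = chainTo F Y n := by
      intro n
      induction n with
      | zero => exact initialIsInitial.hom_ext _ _
      | succ n ih =>
        have a : (F.map (colimit.ι (chain F) n) ≫ str) ≫ g =
            F.map (colimit.ι (chain F) n ≫ g) ≫ Y.str := by
          rw [F.map_comp, Category.assoc, Category.assoc, hm]
        exact (congrArg (· ≫ g) (key n)).symm.trans (a.trans (by rw [ih]; rfl))
    refine Endofunctor.Algebra.ext ?_
    refine hg.symm.trans ?_
    exact (colimit.isColimit (chain F)).hom_ext (fun n => (main n).trans (e1 Y n).symm)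

end Chain

variable [HasColimitsOfShape ℕ B]

section Cata

variable (F : B ⥤ B) (h : OmegaCocontinuous F)

/-- A choice of an initial algebra of an `ω`-cocontinuous endofunctor. -/
noncomputable def initAlg : Endofunctor.Algebra F := (exists_initialAlgebra F h).choose

/-- The chosen initial algebra is initial. -/
noncomputable def initAlgIsInitial : IsInitial (initAlg F h) :=
  (exists_initialAlgebra F h).choose_spec.some

variable {F}

/-- The unique algebra morphism out of the chosen initial algebra. -/
noncomputable def cata {Y : B} (b : F.obj Y ⟶ Y) : (initAlg F h).a ⟶ Y :=
  ((initAlgIsInitial F h).to ⟨Y, b⟩).f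

theorem str_cata {Y : B} (b : F.obj Y ⟶ Y) :
    (initAlg F h).str ≫ cata h b = F.map (cata h b) ≫ b :=
  ((initAlgIsInitial F h).to ⟨Y, b⟩).h.symm

theorem cata_uniq {Y : B} (b : F.obj Y ⟶ Y) (f : (initAlg F h).a ⟶ Y)
    (hf : (initAlg F h).str ≫ f = F.map f ≫ b) : f = cata h b :=
  congrArg Endofunctor.Algebra.Hom.f ((initAlgIsInitial F h).hom_ext
    (⟨f, hf.symm⟩ : initAlg F h ⟶ ⟨Y, b⟩) ((initAlgIsInitial F h).to ⟨Y, b⟩))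

/-- The structure map of the chosen initial algebra is an isomorphism. -/
noncomputable def initAlgIso : F.obj (initAlg F h).a ≅ (initAlg F h).a :=
  haveI := Endofunctor.Algebra.Initial.str_isIso (initAlgIsInitial F h)
  asIso (initAlg F h).str

end Cata

/-- The carriers of the chosen initial algebras of a family of endofunctors. -/
noncomputable def initAlgFunctor (S : A ⥤ B ⥤ B) (h : ∀ X, OmegaCocontinuous (S.obj X)) :
    A ⥤ B where
  obj X := (initAlg (S.obj X) (h X)).a
  map {X Y} f := cata (h X) ((S.map f).app _ ≫ (initAlg (S.obj Y) (h Y)).str)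
  map_id X := by
    symm
    apply cata_uniq
    simp
  map_comp {X Y Z} f g := by
    symm
    apply cata_uniq
    rw [← Category.assoc, str_cata, Category.assoc, Category.assoc, str_cata]
    simp

/-- The functor `T†` underlying the chosen parameterised initial algebra of `T`. -/
noncomputable def daggerFunctor (T : A × B ⥤ B) (hT : OmegaCocontinuous T) : A ⥤ B :=
  initAlgFunctor (Functor.curry.obj T) (curry_obj_cocontinuous T hT)

/-- The natural isomorphism `τ : T ∘ ⟨Id, T†⟩ ≅ T†`. -/
noncomputable def daggerIso (T : A × B ⥤ B) (hT : OmegaCocontinuous T) :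
    (𝟭 A).prod' (daggerFunctor T hT) ⋙ T ≅ daggerFunctor T hT :=
  NatIso.ofComponents
    (fun X =>
      initAlgIso (curry_obj_cocontinuous T hT X))
    (fun {X Y} f => by
      have e := str_cata (curry_obj_cocontinuous T hT X)
        (((Functor.curry.obj T).map f).app _ ≫
          (initAlg ((Functor.curry.obj T).obj Y) (curry_obj_cocontinuous T hT Y)).str)
      refine Eq.trans ?_ e.symm
      have e' : T.map (f ×ₘ (daggerFunctor T hT).map f) =
          T.map (𝟙 X ×ₘ (daggerFunctor T hT).map f) ≫
            T.map (f ×ₘ 𝟙 ((daggerFunctor T hT).obj Y)) := by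
        rw [← T.map_comp]
        exact congrArg T.map (Prod.hom_ext (Category.id_comp _).symm (Category.comp_id _).symm)
      exact (congrArg (· ≫ (initAlg ((Functor.curry.obj T).obj Y)
        (curry_obj_cocontinuous T hT Y)).str) e').trans (Category.assoc _ _ _))

/-- Every `ω`-cocontinuous `T` has a parameterised initial algebra. -/
noncomputable def dagger (T : A × B ⥤ B) (hT : OmegaCocontinuous T) : ParamInitialAlgebra T where
  functor := daggerFunctor T hT
  iso := daggerIso T hT
  isInitial X := initAlgIsInitial ((Functor.curry.obj T).obj X) (curry_obj_cocontinuous T hT X)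

/-- The unique morphism from the initial `T(X, -)`-algebra `T† X` to an algebra. -/
noncomputable def daggerDesc (T : A × B ⥤ B) (hT : OmegaCocontinuous T) (X : A) {Y : B}
    (b : T.obj (X, Y) ⟶ Y) : (dagger T hT).functor.obj X ⟶ Y :=
  cata (curry_obj_cocontinuous T hT X) b

theorem iso_daggerDesc (T : A × B ⥤ B) (hT : OmegaCocontinuous T) (X : A) {Y : B}
    (b : T.obj (X, Y) ⟶ Y) : (dagger T hT).iso.hom.app X ≫ daggerDesc T hT X b =
      T.map (𝟙 X ×ₘ daggerDesc T hT X b) ≫ b :=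
  str_cata (curry_obj_cocontinuous T hT X) b

theorem daggerDesc_uniq (T : A × B ⥤ B) (hT : OmegaCocontinuous T) (X : A) {Y : B}
    (b : T.obj (X, Y) ⟶ Y) (f : (dagger T hT).functor.obj X ⟶ Y)
    (hf : (dagger T hT).iso.hom.app X ≫ f = T.map (𝟙 X ×ₘ f) ≫ b) : f = daggerDesc T hT X b :=
  cata_uniq (curry_obj_cocontinuous T hT X) b f hf

theorem dagger_iso_natural (T : A × B ⥤ B) (hT : OmegaCocontinuous T) {X Y : A} (f : X ⟶ Y) :
    T.map (f ×ₘ (dagger T hT).functor.map f) ≫ (dagger T hT).iso.hom.app Y =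
      (dagger T hT).iso.hom.app X ≫ (dagger T hT).functor.map f :=
  (dagger T hT).iso.hom.naturality f

theorem daggerDesc_fusion (T : A × B ⥤ B) (hT : OmegaCocontinuous T) (X : A) {Y Y' : B}
    (b : T.obj (X, Y) ⟶ Y) (b' : T.obj (X, Y') ⟶ Y') (g : Y ⟶ Y')
    (hg : T.map (𝟙 X ×ₘ g) ≫ b' = b ≫ g) :
    daggerDesc T hT X b ≫ g = daggerDesc T hT X b' := by
  apply daggerDesc_uniq
  rw [← Category.assoc, iso_daggerDesc, ← Category.comp_id (𝟙 X), ← map_comp_map,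
    Category.assoc, Category.assoc, hg, Category.comp_id]

theorem map_daggerDesc (T : A × B ⥤ B) (hT : OmegaCocontinuous T) {X X' : A} (f : X ⟶ X') {Y : B}
    (b : T.obj (X', Y) ⟶ Y) : (dagger T hT).functor.map f ≫ daggerDesc T hT X' b =
      daggerDesc T hT X (T.map (f ×ₘ 𝟙 Y) ≫ b) := by
  apply daggerDesc_uniq
  rw [← Category.assoc, ← dagger_iso_natural, Category.assoc, iso_daggerDesc,
    ← Category.assoc, ← Category.assoc, map_comp_map, map_comp_map, Category.id_comp,
    Category.comp_id, Category.comp_id]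

/-- The functor `T†` is again `ω`-cocontinuous. -/
theorem dagger_cocontinuous (T : A × B ⥤ B) (hT : OmegaCocontinuous T) :
    OmegaCocontinuous (dagger T hT).functor := by
  refine ⟨fun {D} => ⟨fun {c} hc => ?_⟩⟩
  let G := daggerFunctor T hT
  let τ : ∀ X, T.obj (X, G.obj X) ⟶ G.obj X := fun X => (daggerIso T hT).hom.app X
  have hτ : ∀ {X Y : A} (f : X ⟶ Y), T.map (f ×ₘ G.map f) ≫ τ Y = τ X ≫ G.map f :=
    fun f => (daggerIso T hT).hom.naturality f
  have ext : ∀ {X : A} {Y : B} (b : T.obj (X, Y) ⟶ Y) (f g : G.obj X ⟶ Y),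
      τ X ≫ f = T.map (𝟙 X ×ₘ f) ≫ b → τ X ≫ g = T.map (𝟙 X ×ₘ g) ≫ b → f = g :=
    fun {X Y} b f g hf hg =>
      (cata_uniq (curry_obj_cocontinuous T hT X) b f hf).trans
        (cata_uniq (curry_obj_cocontinuous T hT X) b g hg).symm
  let γ : ∀ n, D.obj n ⟶ c.pt := fun n => c.ι.app n
  let L := colimit (D ⋙ G)
  let ι : ∀ n, G.obj (D.obj n) ⟶ L := fun n => colimit.ι (D ⋙ G) n
  have hι : ∀ {i j : ℕ} (f : i ⟶ j), G.map (D.map f) ≫ ι j = ι i := fun f =>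
    colimit.w (D ⋙ G) f
  have hc' := prodIsColimit hc (colimit.isColimit (D ⋙ G))
  have hTc := isColimitOfPreserves T hc'
  let s₀ : Cocone ((D.prod' (D ⋙ G)) ⋙ T) :=
    { pt := L
      ι := { app := fun n => τ (D.obj n) ≫ ι n
             naturality := fun i j f => by
              change T.map (D.map f ×ₘ G.map (D.map f)) ≫ τ _ ≫ ι j = (τ _ ≫ ι i) ≫ 𝟙 L
              rw [← Category.assoc, hτ, Category.assoc, hι, Category.comp_id] } }
  let s : T.obj (c.pt, L) ⟶ L := hTc.desc s₀
  have hs : ∀ n, T.map (γ n ×ₘ ι n) ≫ s = τ (D.obj n) ≫ ι n := fun n => hTc.fac s₀ n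
  let p : L ⟶ G.obj c.pt := colimit.desc (D ⋙ G) (G.mapCocone c)
  have hp : ∀ n, ι n ≫ p = G.map (γ n) := fun n => colimit.ι_desc _ _
  let q : G.obj c.pt ⟶ L := cata (curry_obj_cocontinuous T hT c.pt) s
  have hq : τ c.pt ≫ q = T.map (𝟙 _ ×ₘ q) ≫ s := str_cata (curry_obj_cocontinuous T hT c.pt) s
  have comb : ∀ {X X' X'' : A} {Y Y' Y'' : B} (f : X ⟶ X') (f' : X' ⟶ X'') (g : Y ⟶ Y')
      (g' : Y' ⟶ Y''), T.map (f ×ₘ g) ≫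
        T.map (f' ×ₘ g') = T.map ((f ≫ f') ×ₘ (g ≫ g')) := fun f f' g g' => by
    rw [← T.map_comp]; rfl
  have hpq : p ≫ q = 𝟙 L := by
    refine colimit.hom_ext (fun n => ?_)
    change ι n ≫ p ≫ q = ι n ≫ 𝟙 L
    rw [← Category.assoc, hp, Category.comp_id]
    refine ext (T.map (γ n ×ₘ 𝟙 L) ≫ s) _ _ ?_ ?_
    · rw [← Category.assoc, ← hτ, Category.assoc, hq, ← Category.assoc, ← Category.assoc, comb,
        comb]
      simp
    · rw [← hs, ← Category.assoc, comb]
      simp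
  have hp' : T.map (𝟙 c.pt ×ₘ p) ≫ τ c.pt = s ≫ p := by
    refine hTc.hom_ext (fun n => ?_)
    change T.map (γ n ×ₘ ι n) ≫ _ ≫ _ = T.map (γ n ×ₘ ι n) ≫ s ≫ p
    rw [← Category.assoc, ← Category.assoc, comb, hs, hp, Category.comp_id, hτ, Category.assoc, hp]
  have hqp : q ≫ p = 𝟙 (G.obj c.pt) := by
    refine ext (τ c.pt) _ _ ?_ ?_
    · rw [← Category.assoc, hq, Category.assoc, ← hp', ← Category.assoc, comb, Category.comp_id]
    · rw [Category.comp_id]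
      have : T.map (𝟙 c.pt ×ₘ 𝟙 (G.obj c.pt)) = 𝟙 _ :=
        T.map_id _
      rw [this, Category.id_comp]
  have : IsIso p := ⟨q, hpq, hqp⟩
  exact ⟨IsColimit.ofPointIso (colimit.isColimit (D ⋙ G)) (t := G.mapCocone c) (i := this)⟩

theorem dagger_congr (T T' : A × B ⥤ B) (hT : OmegaCocontinuous T) (hT' : OmegaCocontinuous T')
    (h : T = T') : (dagger T hT).functor = (dagger T' hT').functor := by
  subst h; rfl

/-- With the chosen parameterised initial algebras, `†` commutes with reparameterisation. -/
theorem dagger_comp (F : A' ⥤ A) (T : A × B ⥤ B) (hT : OmegaCocontinuous T)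
    (hT' : OmegaCocontinuous (F.prod (𝟭 B) ⋙ T)) :
    (dagger (F.prod (𝟭 B) ⋙ T) hT').functor = F ⋙ (dagger T hT).functor := by
  have key : Functor.curry.obj (F.prod (𝟭 B) ⋙ T) = F ⋙ Functor.curry.obj T := by
    have h_obj : ∀ X, (Functor.curry.obj (F.prod (𝟭 B) ⋙ T)).obj X =
        (F ⋙ Functor.curry.obj T).obj X := fun X =>
      CategoryTheory.Functor.ext (fun Y => rfl) (fun Y Y' g => by simp)
    refine CategoryTheory.Functor.ext h_obj (fun X X' f => ?_)
    ext Y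
    simp
  have aux : ∀ (S S' : A' ⥤ B ⥤ B) (h : ∀ X, OmegaCocontinuous (S.obj X))
      (h' : ∀ X, OmegaCocontinuous (S'.obj X)), S = S' →
      initAlgFunctor S h = initAlgFunctor S' h' := by
    rintro S S' h h' rfl; rfl
  exact aux _ _ _ (fun X => curry_obj_cocontinuous T hT (F.obj X)) key

end InitialAlgebras

section Powers

universe v u v₁ u₁ v₂ u₂

variable {C : Type u} [Category.{v} C] {P : Type u₁} [Category.{v₁} P] {Q : Type u₂}
  [Category.{v₂} Q]

/-- The underlying type of the power category `Cⁿ`. -/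
abbrev Power (C : Type u) : ℕ → Type u
  | 0 => PUnit
  | n + 1 => Power C n × C

/-- The terminal category. -/
@[reducible] instance terminalCategory : Category.{v} PUnit.{u + 1} where
  Hom := fun _ _ => PUnit
  id := fun _ => ⟨⟩
  comp := fun _ _ => ⟨⟩

/-- The power category: `C⁰` is the terminal category and `Cⁿ⁺¹ = Cⁿ × C`. -/
@[reducible] instance Power.category : ∀ n, Category.{v} (Power C n)
  | 0 => terminalCategory
  | n + 1 => @CategoryTheory.prod' (Power C n) (Power.category n) C _

/-- The projection functors `Πᵢ : Cⁿ ⥤ C`; the last factor has index `0`. -/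
def proj : ∀ {n : ℕ}, Fin n → (Power C n ⥤ C)
  | 0, i => i.elim0
  | n + 1, i => Fin.cases (CategoryTheory.Prod.snd (Power C n) C)
      (fun j => CategoryTheory.Prod.fst (Power C n) C ⋙ proj j) i

/-- The tuple `⟨F₀, …⟩ : P ⥤ Cⁿ` of functors `Fᵢ : P ⥤ C`. -/
def tuple : ∀ {n : ℕ}, (Fin n → (P ⥤ C)) → (P ⥤ Power C n)
  | 0, _ => { obj := fun _ => PUnit.unit, map := fun _ => PUnit.unit }
  | _ + 1, F => (tuple (fun i => F i.succ)).prod' (F 0)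

/-- The functor `Fⁿ : Pⁿ ⥤ Cⁿ`. -/
def powerMap (F : P ⥤ C) : ∀ n : ℕ, Power P n ⥤ Power C n
  | 0 => { obj := fun _ => PUnit.unit, map := fun _ => PUnit.unit }
  | n + 1 => (powerMap F n).prod F

theorem tuple_comp_proj : ∀ {n : ℕ} (F : Fin n → (P ⥤ C)) (i : Fin n), tuple F ⋙ proj i = F i
  | 0, _, i => i.elim0
  | n + 1, F, i => by
      refine Fin.cases ?_ (fun j => ?_) i
      · rfl
      · exact tuple_comp_proj (fun i => F i.succ) j

theorem comp_tuple : ∀ {n : ℕ} (G : Q ⥤ P) (F : Fin n → (P ⥤ C)),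
    G ⋙ tuple F = tuple (fun i => G ⋙ F i)
  | 0, _, _ => rfl
  | n + 1, G, F => by
      have h := comp_tuple G (fun i => F i.succ)
      change (G ⋙ tuple (fun i => F i.succ)).prod' (G ⋙ F 0) = _
      rw [h]
      rfl

theorem tuple_proj : ∀ n : ℕ, tuple (fun i => proj i) = 𝟭 (Power C n)
  | 0 => rfl
  | n + 1 => by
      have h : tuple (fun i : Fin n => CategoryTheory.Prod.fst (Power C n) C ⋙ proj i) =
          CategoryTheory.Prod.fst (Power C n) C := by
        rw [← comp_tuple, tuple_proj n]; rfl
      change (tuple (fun i : Fin n => CategoryTheory.Prod.fst (Power C n) C ⋙ proj i)).prod'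
        (CategoryTheory.Prod.snd (Power C n) C) = _
      rw [h]
      rfl

theorem const_cocontinuous (X : C) : OmegaCocontinuous ((Functor.const P).obj X) := by
  refine ⟨fun {D} => ⟨fun {c} _ => ⟨IsColimit.ofIsoColimit (isColimitConstCocone ℕ X)
    (Cocone.ext (Iso.refl _) (fun n => by exact Category.comp_id _))⟩⟩⟩

theorem prod'_cocontinuous {F : P ⥤ C} {G : P ⥤ Q} (hF : OmegaCocontinuous F)
    (hG : OmegaCocontinuous G) : OmegaCocontinuous (F.prod' G) := by
  refine ⟨fun {D} => ⟨fun {c} hc => ⟨IsColimit.ofIsoColimit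
    (prodIsColimit (isColimitOfPreserves F hc) (isColimitOfPreserves G hc))
    (Cocone.ext (Iso.refl _) (fun n => by exact Category.comp_id _))⟩⟩⟩

theorem fst_cocontinuous : OmegaCocontinuous (CategoryTheory.Prod.fst P Q) := by
  refine ⟨fun {D} => ⟨fun {c} hc => ⟨?_⟩⟩⟩
  let t : Cocone (D ⋙ CategoryTheory.Prod.fst P Q) → Cocone D := fun s =>
    { pt := (s.pt, c.pt.2)
      ι := { app := fun n => (s.ι.app n, (c.ι.app n).2)
             naturality := fun i j f => Prod.hom_ext (s.ι.naturality f)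
              (congrArg (fun f => f.2) (c.ι.naturality f)) } }
  exact
    { desc := fun s => (hc.desc (t s)).1
      fac := fun s n => congrArg (fun f => f.1) (hc.fac (t s) n)
      uniq := fun s m hm => by
        have := hc.uniq (t s) (m, 𝟙 _) (fun n => Prod.hom_ext (hm n) (Category.comp_id _))
        exact congrArg (fun f => f.1) this }

theorem snd_cocontinuous : OmegaCocontinuous (CategoryTheory.Prod.snd P Q) := by
  refine ⟨fun {D} => ⟨fun {c} hc => ⟨?_⟩⟩⟩
  let t : Cocone (D ⋙ CategoryTheory.Prod.snd P Q) → Cocone D := fun s =>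
    { pt := (c.pt.1, s.pt)
      ι := { app := fun n => ((c.ι.app n).1, s.ι.app n)
             naturality := fun i j f => Prod.hom_ext
              (congrArg (fun f => f.1) (c.ι.naturality f)) (s.ι.naturality f) } }
  exact
    { desc := fun s => (hc.desc (t s)).2
      fac := fun s n => congrArg (fun f => f.2) (hc.fac (t s) n)
      uniq := fun s m hm => by
        have := hc.uniq (t s) (𝟙 _, m) (fun n => Prod.hom_ext (Category.comp_id _) (hm n))
        exact congrArg (fun f => f.2) this }

theorem comp_cocontinuous {F : P ⥤ Q} {G : Q ⥤ C} (hF : OmegaCocontinuous F)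
    (hG : OmegaCocontinuous G) : OmegaCocontinuous (F ⋙ G) :=
  inferInstance

theorem proj_cocontinuous : ∀ {n : ℕ} (i : Fin n), OmegaCocontinuous (proj (C := C) i)
  | 0, i => i.elim0
  | n + 1, i => by
      refine Fin.cases ?_ (fun j => ?_) i
      · exact snd_cocontinuous
      · exact comp_cocontinuous fst_cocontinuous (proj_cocontinuous j)

/-- The coproduct functor `+ : C × C ⥤ C`. -/
noncomputable def coprodFunctor (C : Type u) [Category.{v} C] [HasBinaryCoproducts C] :
    C × C ⥤ C where
  obj p := p.1 ⨿ p.2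
  map f := coprod.map f.1 f.2

theorem coprod_cocontinuous [HasBinaryCoproducts C] : OmegaCocontinuous (coprodFunctor C) := by
  refine ⟨fun {D} => ⟨fun {c} hc => ⟨?_⟩⟩⟩
  have h1 : IsColimit ((CategoryTheory.Prod.fst C C).mapCocone c) :=
    (fst_cocontinuous.preservesColimit.preserves hc).some
  have h2 : IsColimit ((CategoryTheory.Prod.snd C C).mapCocone c) :=
    (snd_cocontinuous.preservesColimit.preserves hc).some
  let t1 : Cocone (D ⋙ coprodFunctor C) → Cocone (D ⋙ CategoryTheory.Prod.fst C C) := fun s =>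
    { pt := s.pt
      ι := { app := fun n => coprod.inl ≫ s.ι.app n
             naturality := fun i j f => by
              have := s.w f
              simp [coprodFunctor] at this
              simp [← this] } }
  let t2 : Cocone (D ⋙ coprodFunctor C) → Cocone (D ⋙ CategoryTheory.Prod.snd C C) := fun s =>
    { pt := s.pt
      ι := { app := fun n => coprod.inr ≫ s.ι.app n
             naturality := fun i j f => by
              have := s.w f
              simp [coprodFunctor] at this
              simp [← this] } }
  have f1 : ∀ s n, (c.ι.app n).1 ≫ h1.desc (t1 s) = coprod.inl ≫ s.ι.app n := fun s n =>
    h1.fac (t1 s) n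
  have f2 : ∀ s n, (c.ι.app n).2 ≫ h2.desc (t2 s) = coprod.inr ≫ s.ι.app n := fun s n =>
    h2.fac (t2 s) n
  exact
    { desc := fun s => coprod.desc (h1.desc (t1 s)) (h2.desc (t2 s))
      fac := fun s n => by
        change coprod.map (c.ι.app n).1 (c.ι.app n).2 ≫ coprod.desc _ _ = _
        refine coprod.hom_ext ?_ ?_
        · rw [coprod.inl_map_assoc, coprod.inl_desc]; exact f1 s n
        · rw [coprod.inr_map_assoc, coprod.inr_desc]; exact f2 s n
      uniq := fun s m hm => by
        have hm' : ∀ n, coprod.map (c.ι.app n).1 (c.ι.app n).2 ≫ m = s.ι.app n := hm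
        refine coprod.hom_ext ?_ ?_
        · rw [coprod.inl_desc]
          refine h1.hom_ext (fun n => ?_)
          refine Eq.trans ?_ (f1 s n).symm
          exact (Category.assoc _ _ _).symm.trans ((congrArg (· ≫ m)
            (coprod.inl_map (c.ι.app n).1 (c.ι.app n).2).symm).trans
              ((Category.assoc _ _ _).trans (congrArg (coprod.inl ≫ ·) (hm' n))))
        · rw [coprod.inr_desc]
          refine h2.hom_ext (fun n => ?_)
          refine Eq.trans ?_ (f2 s n).symm
          exact (Category.assoc _ _ _).symm.trans ((congrArg (· ≫ m)
            (coprod.inr_map (c.ι.app n).1 (c.ι.app n).2).symm).trans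
              ((Category.assoc _ _ _).trans (congrArg (coprod.inr ≫ ·) (hm' n)))) }

end Powers

section AffineLift

universe v u v₁ u₁ v₂ u₂

variable {C : Type u} [Category.{v} C] {P : Type u₁} [Category.{v₁} P] {Q : Type u₂}
  [Category.{v₂} Q]

/-- A choice of discarding maps for `T : P ⥤ C` relative to `U : Q ⥤ P`, natural in `Q`. This is
the same as a functor `H : Q ⥤ C / I` into the slice category whose composite with the forgetful
functor `C / I ⥤ C` equals `T ∘ U`. -/
structure AffineLift (I : C) (U : Q ⥤ P) (T : P ⥤ C) where
  discard : ∀ X : Q, T.obj (U.obj X) ⟶ I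
  natural : ∀ {X Y : Q} (f : X ⟶ Y), T.map (U.map f) ≫ discard Y = discard X

namespace AffineLift

variable {I : C} {U : Q ⥤ P}

/-- The functor into the slice category given by a choice of discarding maps. -/
def functor {T : P ⥤ C} (L : AffineLift I U T) : Q ⥤ Over I where
  obj X := Over.mk (L.discard X)
  map f := Over.homMk (T.map (U.map f)) (L.natural f)

theorem functor_comp_forget {T : P ⥤ C} (L : AffineLift I U T) :
    L.functor ⋙ Over.forget I = U ⋙ T := rfl

variable [HasInitial C] [HasColimitsOfShape ℕ C] {T : P × C ⥤ C}

/-- The discarding maps of `T†`: on `T† (U X)` it is the unique morphism out of the initial algebra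
which makes the structure map of the initial algebra a morphism of the slice category. -/
noncomputable def dagger (L : AffineLift I (U.prod (Over.forget I)) T)
    (hT : OmegaCocontinuous T) : AffineLift I U (AffineLang.dagger T hT).functor where
  discard X := daggerDesc T hT (U.obj X) (L.discard (X, Over.mk (𝟙 I)))
  natural {X Y} f := by
    have h3 : T.map (U.map f ×ₘ 𝟙 I) ≫ L.discard (Y, Over.mk (𝟙 I)) =
        L.discard (X, Over.mk (𝟙 I)) :=
      L.natural (X := (X, Over.mk (𝟙 I))) (Y := (Y, Over.mk (𝟙 I))) (f, 𝟙 _)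
    exact (map_daggerDesc T hT (U.map f) (L.discard (Y, Over.mk (𝟙 I)))).trans
      (congrArg (fun b => daggerDesc T hT (U.obj X) b) h3)

theorem iso_dagger (L : AffineLift I (U.prod (Over.forget I)) T) (hT : OmegaCocontinuous T)
    (X : Q) : (AffineLang.dagger T hT).iso.hom.app (U.obj X) ≫ (L.dagger hT).discard X =
      L.discard (X, (L.dagger hT).functor.obj X) := by
  have h1 := iso_daggerDesc T hT (U.obj X) (L.discard (X, Over.mk (𝟙 I)))
  have h2 := L.natural (X := (X, (L.dagger hT).functor.obj X)) (Y := (X, Over.mk (𝟙 I)))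
    (𝟙 X, Over.homMk ((L.dagger hT).discard X) (Category.comp_id _))
  refine h1.trans (Eq.trans ?_ h2)
  refine congrArg (· ≫ _) (congrArg T.map (Prod.hom_ext ?_ ?_))
  · exact (U.map_id X).symm
  · rfl

theorem map_desc (L : AffineLift I (U.prod (Over.forget I)) T) (hT : OmegaCocontinuous T) (X : Q)
    {Y : Over I} (b : L.functor.obj (X, Y) ⟶ Y) :
    daggerDesc T hT (U.obj X) (Y := Y.left) b.left ≫ Y.hom = (L.dagger hT).discard X := by
  have h2 : T.map (𝟙 (U.obj X) ×ₘ Y.hom) ≫ L.discard (X, Over.mk (𝟙 I)) = L.discard (X, Y) := by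
    rw [← U.map_id]
    exact L.natural (X := (X, Y)) (Y := (X, Over.mk (𝟙 I)))
      (𝟙 X, Over.homMk Y.hom (Category.comp_id _))
  have hb : b.left ≫ Y.hom = L.discard (X, Y) := Over.w b
  exact daggerDesc_fusion T hT (U.obj X) (Y := Y.left) (Y' := I) b.left _ Y.hom (h2.trans hb.symm)

/-- The functor `H†` of the lifted discarding maps is a parameterised initial algebra, in the slice
category, of the lifted functor `H`; it lies strictly over the parameterised initial algebra `T†`,
and so does its structure isomorphism. -/
noncomputable def daggerAlgebra (L : AffineLift I (U.prod (Over.forget I)) T)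
    (hT : OmegaCocontinuous T) : ParamInitialAlgebra L.functor where
  functor := (L.dagger hT).functor
  iso := NatIso.ofComponents
    (fun X => Over.isoMk ((AffineLang.dagger T hT).iso.app (U.obj X)) (iso_dagger L hT X))
    (fun {X Y} f => by
      ext
      exact (AffineLang.dagger T hT).iso.hom.naturality (U.map f))
  isInitial X := IsInitial.ofUniqueHom
    (fun Y =>
      { f := Over.homMk (daggerDesc T hT (U.obj X) (Y := Y.a.left) Y.str.left)
          (map_desc L hT X Y.str)
        h := by
          ext
          refine Eq.trans ?_ (iso_daggerDesc T hT (U.obj X) (Y := Y.a.left) Y.str.left).symm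
          exact congrArg (· ≫ Y.str.left)
            (congrArg T.map (Prod.hom_ext (U.map_id X) rfl)) })
    (fun Y m => by
      refine Endofunctor.Algebra.ext ?_
      ext
      refine daggerDesc_uniq T hT (U.obj X) (Y := Y.a.left) Y.str.left m.f.left ?_
      refine (congrArg (fun g => g.left) m.h).symm.trans ?_
      exact congrArg (· ≫ Y.str.left) (congrArg T.map (Prod.hom_ext (U.map_id X) rfl)))

/-- The discarding maps of the projection functors: those of the given objects of the slice. -/
def proj {I : C} : ∀ {n : ℕ} (i : Fin n),
    AffineLift I (powerMap (Over.forget I) n) (AffineLang.proj i)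
  | 0, i => i.elim0
  | n + 1, i => Fin.cases
      (motive := fun i => AffineLift I (powerMap (Over.forget I) (n + 1)) (AffineLang.proj i))
      { discard := fun X => X.2.hom
        natural := fun f => Over.w f.2 }
      (fun j =>
        { discard := fun X => (AffineLift.proj j).discard X.1
          natural := fun f => (AffineLift.proj j).natural f.1 }) i

end AffineLift

end AffineLift

/-! ### Types -/

section Types

universe w v u

variable {𝒜 : Type w}

/-- Well-formed types in a context of `n` type variables, over a set `𝒜` of atomic types. Type
variables are de Bruijn indices: in `mu A` the bound variable is variable `0` of `A`. -/
inductive Ty (𝒜 : Type w) : ℕ → Type w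
  | var {n : ℕ} (i : Fin n) : Ty 𝒜 n
  | unit {n : ℕ} : Ty 𝒜 n
  | atom {n : ℕ} (a : 𝒜) : Ty 𝒜 n
  | sum {n : ℕ} (A B : Ty 𝒜 n) : Ty 𝒜 n
  | tensor {n : ℕ} (A B : Ty 𝒜 n) : Ty 𝒜 n
  | mu {n : ℕ} (A : Ty 𝒜 (n + 1)) : Ty 𝒜 n

namespace Ty

/-- Extension of a renaming under a binder. -/
def liftRen {n m : ℕ} (ρ : Fin n → Fin m) : Fin (n + 1) → Fin (m + 1) :=
  Fin.cases 0 (fun i => (ρ i).succ)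

/-- Renaming of type variables. -/
def rename : ∀ {n m : ℕ}, (Fin n → Fin m) → Ty 𝒜 n → Ty 𝒜 m
  | _, _, ρ, var i => var (ρ i)
  | _, _, _, unit => unit
  | _, _, _, atom a => atom a
  | _, _, ρ, sum A B => sum (rename ρ A) (rename ρ B)
  | _, _, ρ, tensor A B => tensor (rename ρ A) (rename ρ B)
  | _, _, ρ, mu A => mu (rename (liftRen ρ) A)

/-- Extension of a substitution under a binder. -/
def liftSub {n m : ℕ} (σ : Fin n → Ty 𝒜 m) : Fin (n + 1) → Ty 𝒜 (m + 1) :=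
  Fin.cases (var 0) (fun i => rename Fin.succ (σ i))

/-- Simultaneous capture-avoiding substitution. -/
def subst : ∀ {n m : ℕ}, (Fin n → Ty 𝒜 m) → Ty 𝒜 n → Ty 𝒜 m
  | _, _, σ, var i => σ i
  | _, _, _, unit => unit
  | _, _, _, atom a => atom a
  | _, _, σ, sum A B => sum (subst σ A) (subst σ B)
  | _, _, σ, tensor A B => tensor (subst σ A) (subst σ B)
  | _, _, σ, mu A => mu (subst (liftSub σ) A)

/-- The substitution `A[B/X]`, where `X` is variable `0` of `A`. -/
def inst {n : ℕ} (A : Ty 𝒜 (n + 1)) (B : Ty 𝒜 n) : Ty 𝒜 n :=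
  subst (Fin.cases B (fun i => var i)) A

/-- The type `bit = I + I`. -/
def bit : Ty 𝒜 0 := sum unit unit

end Ty

set_option linter.checkUnivs false in
/-- A categorical model: a symmetric monoidal category with an initial object and binary
coproducts over which `⊗` distributes, with an interpretation of the atomic types by objects
equipped with discarding maps, with `ω`-colimits which `⊗` preserves, and enriched in pointed dcpos
and strict Scott-continuous maps, such that `⊗` and the coproducts are Scott-continuous. -/
structure Model (𝒜 : Type w) where
  C : Type u
  [category : Category.{v} C]
  [monoidal : MonoidalCategory C]
  [symmetric : SymmetricCategory C]
  [hasInitial : HasInitial C]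
  [hasBinaryCoproducts : HasBinaryCoproducts C]
  [distrib : IsMonoidalDistrib C]
  atom : 𝒜 → C
  atomDiscard : ∀ a, atom a ⟶ 𝟙_ C
  [hasOmegaColimits : HasColimitsOfShape ℕ C]
  tensor_cocontinuous : OmegaCocontinuous (tensor C)
  [dcpo : ∀ X Y : C, CompletePartialOrder (X ⟶ Y)]
  comp_continuous : ∀ X Y Z : C, ScottContinuous (fun p : (X ⟶ Y) × (Y ⟶ Z) => p.1 ≫ p.2)
  bot_comp : ∀ {X Y Z : C} (g : Y ⟶ Z), (⊥ : X ⟶ Y) ≫ g = ⊥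
  comp_bot : ∀ {X Y Z : C} (f : X ⟶ Y), f ≫ (⊥ : Y ⟶ Z) = ⊥
  tensor_continuous : ∀ X Y X' Y' : C,
    ScottContinuous (fun p : (X ⟶ Y) × (X' ⟶ Y') => p.1 ⊗ₘ p.2)
  coprod_continuous : ∀ X Y Z : C,
    ScottContinuous (fun p : (X ⟶ Z) × (Y ⟶ Z) => coprod.desc p.1 p.2)

attribute [instance] Model.category Model.monoidal Model.symmetric Model.hasInitial
  Model.hasBinaryCoproducts Model.distrib Model.hasOmegaColimits Model.dcpo

variable (M : Model.{w, v, u} 𝒜)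

/-- The standard interpretation `⟦Θ ⊢ A⟧ : C^|Θ| ⥤ C` of types, an `ω`-cocontinuous functor. -/
noncomputable def Ty.interp : ∀ {n : ℕ}, Ty 𝒜 n →
    {T : Power M.C n ⥤ M.C // OmegaCocontinuous T}
  | _, var i => ⟨proj i, proj_cocontinuous i⟩
  | _, unit => ⟨(Functor.const _).obj (𝟙_ M.C), const_cocontinuous _⟩
  | _, atom a => ⟨(Functor.const _).obj (M.atom a), const_cocontinuous _⟩
  | _, sum A B => ⟨A.interp.1.prod' B.interp.1 ⋙ coprodFunctor M.C,
      comp_cocontinuous (prod'_cocontinuous A.interp.2 B.interp.2) coprod_cocontinuous⟩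
  | _, tensor A B => ⟨A.interp.1.prod' B.interp.1 ⋙ MonoidalCategory.tensor M.C,
      comp_cocontinuous (prod'_cocontinuous A.interp.2 B.interp.2) M.tensor_cocontinuous⟩
  | n, mu A => ⟨(dagger (A := Power M.C n) A.interp.1 A.interp.2).functor,
      dagger_cocontinuous (A := Power M.C n) A.interp.1 A.interp.2⟩

/-- The discarding maps of the affine interpretation of types. The object `⟦Θ ⊢ A⟧ X` of the slice
category consists of the standard interpretation of `A` and of the following discarding map:
that of `X` for variables, the identity for `I`, the chosen one for atomic types, `[◇, ◇]` for
sums, `λ ∘ (◇ ⊗ ◇)` for tensors, and that of the parameterised initial algebra in the slice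
category (see `AffineLift.daggerAlgebra`) for inductive types. -/
noncomputable def Ty.affineLift : ∀ {n : ℕ} (A : Ty 𝒜 n),
    AffineLift (𝟙_ M.C) (powerMap (Over.forget (𝟙_ M.C)) n) (A.interp M).1
  | _, var i => AffineLift.proj i
  | _, unit =>
    { discard := fun _ => 𝟙 (𝟙_ M.C)
      natural := fun _ => Category.comp_id _ }
  | _, atom a =>
    { discard := fun _ => M.atomDiscard a
      natural := fun _ => Category.id_comp _ }
  | _, sum A B =>
    { discard := fun X => coprod.desc (A.affineLift.discard X) (B.affineLift.discard X)
      natural := fun {X Y} f => by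
        refine (coprod.map_desc _ _ _ _).trans ?_
        exact congrArg₂ coprod.desc (A.affineLift.natural f) (B.affineLift.natural f) }
  | _, tensor A B =>
    { discard := fun X => (A.affineLift.discard X ⊗ₘ B.affineLift.discard X) ≫ (λ_ (𝟙_ M.C)).hom
      natural := fun {X Y} f => by
        refine (Category.assoc _ _ _).symm.trans (congrArg (· ≫ (λ_ (𝟙_ M.C)).hom) ?_)
        refine (tensorHom_comp_tensorHom _ _ _ _).trans ?_
        exact congrArg₂ tensorHom (A.affineLift.natural f) (B.affineLift.natural f) }
  | n, mu A => A.affineLift.dagger (A.interp M).2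

end Types

section Folding

universe w v u

variable {𝒜 : Type w} (M : Model.{w, v, u} 𝒜)

namespace Ty

/-- The affine interpretation `C_a^|Θ| ⥤ C_a` of types, where `C_a = C / I`. -/
noncomputable def affineInterp {n : ℕ} (A : Ty 𝒜 n) :
    Power (Over (𝟙_ M.C)) n ⥤ Over (𝟙_ M.C) :=
  (A.affineLift M).functor

/-- The coproduct functor `+_a` of the slice category: `(X, ◇) + (Y, ◇) = (X + Y, [◇, ◇])`. -/
noncomputable def sliceCoprod (I : M.C) : Over I × Over I ⥤ Over I where
  obj p := Over.mk (coprod.desc p.1.hom p.2.hom)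
  map f := Over.homMk (coprod.map f.1.left f.2.left)
    ((coprod.map_desc _ _ _ _).trans (congrArg₂ coprod.desc (Over.w f.1) (Over.w f.2)))

/-- The tensor functor `⊗_a` of the slice category over the tensor unit:
`(X, ◇) ⊗ (Y, ◇) = (X ⊗ Y, λ ∘ (◇ ⊗ ◇))`. -/
noncomputable def sliceTensor : Over (𝟙_ M.C) × Over (𝟙_ M.C) ⥤ Over (𝟙_ M.C) where
  obj p := Over.mk ((p.1.hom ⊗ₘ p.2.hom) ≫ (λ_ (𝟙_ M.C)).hom)
  map f := Over.homMk (f.1.left ⊗ₘ f.2.left) ((Category.assoc _ _ _).symm.trans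
    (congrArg (· ≫ (λ_ (𝟙_ M.C)).hom) ((tensorHom_comp_tensorHom _ _ _ _).trans
      (congrArg₂ tensorHom (Over.w f.1) (Over.w f.2)))))

theorem affineInterp_sum {n : ℕ} (A B : Ty 𝒜 n) : (sum A B).affineInterp M =
    (A.affineInterp M).prod' (B.affineInterp M) ⋙ sliceCoprod M (𝟙_ M.C) := rfl

theorem affineInterp_tensor {n : ℕ} (A B : Ty 𝒜 n) : (tensor A B).affineInterp M =
    (A.affineInterp M).prod' (B.affineInterp M) ⋙ sliceTensor M := rfl

/-- The affine interpretation lies strictly over the standard one. -/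
theorem affineInterp_comp_forget {n : ℕ} (A : Ty 𝒜 n) :
    A.affineInterp M ⋙ Over.forget (𝟙_ M.C) =
      powerMap (Over.forget (𝟙_ M.C)) n ⋙ (A.interp M).1 := rfl

/-- The affine interpretation of `μX.A` is the functor `⟦A⟧†` underlying a parameterised initial
algebra of the affine interpretation of `A`. -/
theorem affineInterp_mu {n : ℕ} (A : Ty 𝒜 (n + 1)) :
    ((mu A).affineInterp M) = ((A.affineLift M).daggerAlgebra (A.interp M).2 :
      ParamInitialAlgebra (A := Power (Over (𝟙_ M.C)) n) (A.affineInterp M)).functor := rfl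

/-- The object `⟦A⟧` for a closed type `A`. -/
noncomputable def obj (A : Ty 𝒜 0) : M.C := (A.interp M).1.obj PUnit.unit

/-- The discarding map `⟦A⟧ ⟶ I` of a closed type `A`, given by its affine interpretation. -/
noncomputable def discard (A : Ty 𝒜 0) : A.obj M ⟶ 𝟙_ M.C :=
  ((A.affineInterp M).obj PUnit.unit).hom

theorem tuple_liftRen {n m : ℕ} (ρ : Fin n → Fin m) :
    tuple (fun i => proj (C := M.C) (liftRen ρ i)) =
      (tuple (fun i => proj (C := M.C) (ρ i))).prod (𝟭 M.C) := by
  have h := comp_tuple (CategoryTheory.Prod.fst (Power M.C m) M.C)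
    (fun i => proj (C := M.C) (ρ i))
  change (tuple (fun i => CategoryTheory.Prod.fst (Power M.C m) M.C ⋙
    proj (C := M.C) (ρ i))).prod' (CategoryTheory.Prod.snd (Power M.C m) M.C) = _
  rw [← h]
  rfl

theorem interp_rename : ∀ {n m : ℕ} (A : Ty 𝒜 n) (ρ : Fin n → Fin m),
    ((A.rename ρ).interp M).1 = tuple (fun i => proj (ρ i)) ⋙ (A.interp M).1
  | _, _, var i, ρ => (tuple_comp_proj (fun i => proj (ρ i)) i).symm
  | _, _, unit, _ => rfl
  | _, _, atom _, _ => rfl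
  | _, _, sum A B, ρ => by
      change ((A.rename ρ).interp M).1.prod' ((B.rename ρ).interp M).1 ⋙ _ = _
      rw [interp_rename A ρ, interp_rename B ρ]; rfl
  | _, _, tensor A B, ρ => by
      change ((A.rename ρ).interp M).1.prod' ((B.rename ρ).interp M).1 ⋙ _ = _
      rw [interp_rename A ρ, interp_rename B ρ]; rfl
  | n, m, mu A, ρ => by
      have h := interp_rename A (liftRen ρ)
      rw [tuple_liftRen] at h
      exact (dagger_congr (A := Power M.C m) _ _ ((A.rename (liftRen ρ)).interp M).2
        (h ▸ ((A.rename (liftRen ρ)).interp M).2) h).trans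
        (dagger_comp (A := Power M.C n) _ _ (A.interp M).2 _)

theorem tuple_liftSub {n m : ℕ} (σ : Fin n → Ty 𝒜 m) :
    tuple (fun i => ((liftSub σ i).interp M).1) =
      (tuple (fun i => ((σ i).interp M).1)).prod (𝟭 M.C) := by
  have h := comp_tuple (CategoryTheory.Prod.fst (Power M.C m) M.C)
    (fun i => ((σ i).interp M).1)
  have hfst : tuple (fun i : Fin m => proj (C := M.C) i.succ) =
      CategoryTheory.Prod.fst (Power M.C m) M.C := by
    have := comp_tuple (CategoryTheory.Prod.fst (Power M.C m) M.C) (fun i => proj (C := M.C) i)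
    rw [tuple_proj] at this
    exact this.symm
  have hs : (fun i => ((rename Fin.succ (σ i)).interp M).1) =
      fun i => CategoryTheory.Prod.fst (Power M.C m) M.C ⋙ ((σ i).interp M).1 := by
    funext i
    rw [interp_rename, hfst]
  change (tuple (fun i => ((rename Fin.succ (σ i)).interp M).1)).prod'
    (CategoryTheory.Prod.snd (Power M.C m) M.C) = _
  rw [hs, ← h]
  rfl

theorem interp_subst : ∀ {n m : ℕ} (A : Ty 𝒜 n) (σ : Fin n → Ty 𝒜 m),
    ((A.subst σ).interp M).1 = tuple (fun i => ((σ i).interp M).1) ⋙ (A.interp M).1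
  | _, _, var i, σ => (tuple_comp_proj (fun i => ((σ i).interp M).1) i).symm
  | _, _, unit, _ => rfl
  | _, _, atom _, _ => rfl
  | _, _, sum A B, σ => by
      change ((A.subst σ).interp M).1.prod' ((B.subst σ).interp M).1 ⋙ _ = _
      rw [interp_subst A σ, interp_subst B σ]; rfl
  | _, _, tensor A B, σ => by
      change ((A.subst σ).interp M).1.prod' ((B.subst σ).interp M).1 ⋙ _ = _
      rw [interp_subst A σ, interp_subst B σ]; rfl
  | n, m, mu A, σ => by
      have h := interp_subst A (liftSub σ)
      rw [tuple_liftSub] at h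
      exact (dagger_congr (A := Power M.C m) _ _ ((A.subst (liftSub σ)).interp M).2
        (h ▸ ((A.subst (liftSub σ)).interp M).2) h).trans
        (dagger_comp (A := Power M.C n) _ _ (A.interp M).2 _)

/-- Type substitution: `⟦Θ ⊢ A[B/X]⟧ = ⟦Θ, X ⊢ A⟧ ∘ ⟨Id, ⟦Θ ⊢ B⟧⟩`. -/
theorem interp_inst {n : ℕ} (A : Ty 𝒜 (n + 1)) (B : Ty 𝒜 n) :
    ((A.inst B).interp M).1 = (𝟭 (Power M.C n)).prod' (B.interp M).1 ⋙ (A.interp M).1 := by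
  refine (interp_subst M A _).trans ?_
  refine congrArg (· ⋙ (A.interp M).1) ?_
  change (tuple (fun i : Fin n => proj (C := M.C) i)).prod' (B.interp M).1 = _
  rw [tuple_proj]

/-- The isomorphism `fold : ⟦A[μX.A/X]⟧ = ⟦X ⊢ A⟧⟦μX.A⟧ ≅ ⟦μX.A⟧`; its inverse is `unfold`. -/
noncomputable def foldIso (A : Ty 𝒜 1) : (A.inst (mu A)).obj M ≅ (mu A).obj M :=
  eqToIso (congrArg (fun T => T.obj PUnit.unit) (interp_inst M A (mu A))) ≪≫
    (dagger (A := Power M.C 0) (A.interp M).1 (A.interp M).2).iso.app PUnit.unit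

end Ty

end Folding

/-! ### Terms, values and configurations -/

section Language

universe x w

variable {Var : Type x} [LinearOrder Var] {𝒜 : Type w}

/-- Terms. The variables assigned to are written first, as in `y = left x`. -/
inductive Term (Var : Type x) (𝒜 : Type w) : Type (max x w)
  /-- `new unit u` -/
  | newUnit (u : Var)
  /-- `discard x` -/
  | discard (x : Var)
  /-- `M; N` -/
  | seq (M N : Term Var 𝒜)
  /-- `skip` -/
  | skip
  /-- `while b do M` -/
  | whileDo (b : Var) (M : Term Var 𝒜)
  /-- `y = left_{A,B} x` -/
  | left (y : Var) (A B : Ty 𝒜 0) (x : Var)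
  /-- `y = right_{A,B} x` -/
  | right (y : Var) (A B : Ty 𝒜 0) (x : Var)
  /-- `case y of {left x₁ → M₁ | right x₂ → M₂}` -/
  | caseOf (y : Var) (x₁ : Var) (M₁ : Term Var 𝒜) (x₂ : Var) (M₂ : Term Var 𝒜)
  /-- `x = (x₁, x₂)` -/
  | pair (x x₁ x₂ : Var)
  /-- `(x₁, x₂) = x` -/
  | unpair (x₁ x₂ x : Var)
  /-- `y = fold_{μX.A} x` -/
  | fold (y : Var) (A : Ty 𝒜 1) (x : Var)
  /-- `y = unfold x` -/
  | unfold (y x : Var)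

/-- Values. -/
inductive Val (𝒜 : Type w) : Type w
  | star
  | left (A B : Ty 𝒜 0) (v : Val 𝒜)
  | right (A B : Ty 𝒜 0) (v : Val 𝒜)
  | pair (v w : Val 𝒜)
  | fold (A : Ty 𝒜 1) (v : Val 𝒜)

/-- Derivations of `⊢ v : A`. -/
inductive Val.HasTy : Val 𝒜 → Ty 𝒜 0 → Type w
  | star : HasTy .star .unit
  | left {A B : Ty 𝒜 0} {v : Val 𝒜} (h : HasTy v A) : HasTy (.left A B v) (.sum A B)
  | right {A B : Ty 𝒜 0} {v : Val 𝒜} (h : HasTy v B) : HasTy (.right A B v) (.sum A B)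
  | pair {A B : Ty 𝒜 0} {v w : Val 𝒜} (h : HasTy v A) (k : HasTy w B) :
      HasTy (.pair v w) (.tensor A B)
  | fold {A : Ty 𝒜 1} {v : Val 𝒜} (h : HasTy v (A.inst (.mu A))) : HasTy (.fold A v) (.mu A)

/-- Finite maps `{x₁ ↦ b₁, …, xₙ ↦ bₙ}` from variables, listed from the greatest variable to the
least one, so that every finite map has exactly one representation. -/
@[ext]
structure FMap (Var : Type x) [LinearOrder Var] (β : Type w) where
  entries : List (Var × β)
  sorted : entries.Pairwise (fun p q => q.1 < p.1)

/-- Variable contexts `Γ = x₁ : A₁, …, xₙ : Aₙ`; the variables are distinct and the order in which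
they are declared is irrelevant. -/
abbrev Ctx (Var : Type x) [LinearOrder Var] (𝒜 : Type w) := FMap Var (Ty 𝒜 0)

/-- Value assignments `V = {x₁ = v₁, …, xₙ = vₙ}`. -/
abbrev Assign (Var : Type x) [LinearOrder Var] (𝒜 : Type w) := FMap Var (Val 𝒜)

/-- `Insertion x b l l'`: the list `l'` is obtained by inserting `(x, b)` into `l`. -/
inductive Insertion {β : Type w} (x : Var) (b : β) :
    List (Var × β) → List (Var × β) → Type (max x w)
  | here (l : List (Var × β)) : Insertion x b l ((x, b) :: l)
  | there (p : Var × β) {l l' : List (Var × β)} (i : Insertion x b l l') :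
      Insertion x b (p :: l) (p :: l')

/-- `Extends m x b m'`: the finite map `m'` is `m, x ↦ b`, where `x` is not in the domain of `m`
(since `m'` has distinct variables). -/
abbrev Extends {β : Type w} (m : FMap Var β) (x : Var) (b : β) (m' : FMap Var β) :
    Type (max x w) :=
  Insertion x b m.entries m'.entries

/-- Derivations of the term judgement `⊢ ⟨Γ⟩ M ⟨Σ⟩`. -/
inductive Term.Typed : Ctx Var 𝒜 → Term Var 𝒜 → Ctx Var 𝒜 → Type (max x w)
  | newUnit {Γ Γ' : Ctx Var 𝒜} {u : Var} (e : Extends Γ u .unit Γ') : Typed Γ (.newUnit u) Γ'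
  | discard {Γ Γ' : Ctx Var 𝒜} {x : Var} {A : Ty 𝒜 0} (e : Extends Γ x A Γ') :
      Typed Γ' (.discard x) Γ
  | seq {Γ Γ' S : Ctx Var 𝒜} {M N : Term Var 𝒜} (h : Typed Γ M Γ') (k : Typed Γ' N S) :
      Typed Γ (.seq M N) S
  | skip {Γ : Ctx Var 𝒜} : Typed Γ .skip Γ
  | whileDo {Γ Γ' : Ctx Var 𝒜} {b : Var} {M : Term Var 𝒜} (e : Extends Γ b .bit Γ')
      (h : Typed Γ' M Γ') : Typed Γ' (.whileDo b M) Γ'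
  | left {Γ Γ₁ Γ₂ : Ctx Var 𝒜} {x y : Var} {A B : Ty 𝒜 0} (e₁ : Extends Γ x A Γ₁)
      (e₂ : Extends Γ y (.sum A B) Γ₂) : Typed Γ₁ (.left y A B x) Γ₂
  | right {Γ Γ₁ Γ₂ : Ctx Var 𝒜} {x y : Var} {A B : Ty 𝒜 0} (e₁ : Extends Γ x B Γ₁)
      (e₂ : Extends Γ y (.sum A B) Γ₂) : Typed Γ₁ (.right y A B x) Γ₂
  | caseOf {Γ Γ' Γ₁ Γ₂ S : Ctx Var 𝒜} {y x₁ x₂ : Var} {A B : Ty 𝒜 0} {M₁ M₂ : Term Var 𝒜}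
      (e : Extends Γ y (.sum A B) Γ')
      (e₁ : Extends Γ x₁ A Γ₁) (h₁ : Typed Γ₁ M₁ S)
      (e₂ : Extends Γ x₂ B Γ₂) (h₂ : Typed Γ₂ M₂ S) :
      Typed Γ' (.caseOf y x₁ M₁ x₂ M₂) S
  | pair {Γ Γ₁ Γ₂ Γ' : Ctx Var 𝒜} {x x₁ x₂ : Var} {A B : Ty 𝒜 0}
      (e₁ : Extends Γ x₁ A Γ₁) (e₂ : Extends Γ₁ x₂ B Γ₂) (e : Extends Γ x (.tensor A B) Γ') :
      Typed Γ₂ (.pair x x₁ x₂) Γ'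
  | unpair {Γ Γ₁ Γ₂ Γ' : Ctx Var 𝒜} {x x₁ x₂ : Var} {A B : Ty 𝒜 0}
      (e : Extends Γ x (.tensor A B) Γ') (e₁ : Extends Γ x₁ A Γ₁) (e₂ : Extends Γ₁ x₂ B Γ₂) :
      Typed Γ' (.unpair x₁ x₂ x) Γ₂
  | fold {Γ Γ₁ Γ₂ : Ctx Var 𝒜} {x y : Var} {A : Ty 𝒜 1} (e₁ : Extends Γ x (A.inst (.mu A)) Γ₁)
      (e₂ : Extends Γ y (.mu A) Γ₂) : Typed Γ₁ (.fold y A x) Γ₂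
  | unfold {Γ Γ₁ Γ₂ : Ctx Var 𝒜} {x y : Var} {A : Ty 𝒜 1} (e₁ : Extends Γ x (.mu A) Γ₁)
      (e₂ : Extends Γ y (A.inst (.mu A)) Γ₂) : Typed Γ₁ (.unfold y x) Γ₂

/-- Program configurations `(M | V)`. -/
@[ext]
structure Config (Var : Type x) [LinearOrder Var] (𝒜 : Type w) where
  term : Term Var 𝒜
  assign : Assign Var 𝒜

/-- Typing of the entries of a value assignment by those of a variable context. -/
inductive AssignTyped : List (Var × Ty 𝒜 0) → List (Var × Val 𝒜) → Type (max x w)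
  | nil : AssignTyped [] []
  | cons {l : List (Var × Ty 𝒜 0)} {l' : List (Var × Val 𝒜)} (h : AssignTyped l l') (x : Var)
      {A : Ty 𝒜 0} {v : Val 𝒜} (k : v.HasTy A) : AssignTyped ((x, A) :: l) ((x, v) :: l')

/-- Derivations of `Γ ⊢ V`: the value assignment `V` has the same variables as `Γ`, and assigns
to each of them a value of the right type. -/
abbrev Assign.Typed (Γ : Ctx Var 𝒜) (V : Assign Var 𝒜) : Type (max x w) :=
  AssignTyped Γ.entries V.entries

/-- Derivations of `Γ; Σ ⊢ (M | V)`. -/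
structure Config.WellFormed (Γ S : Ctx Var 𝒜) (c : Config Var 𝒜) where
  term : c.term.Typed Γ S
  assign : c.assign.Typed Γ

/-- `if b then {M}`, which abbreviates
`case b of {left u → b = left u | right u → b = right u; M}`. -/
def Term.ifThen (b u : Var) (M : Term Var 𝒜) : Term Var 𝒜 :=
  .caseOf b u (.left b .unit .unit u) u (.seq (.right b .unit .unit u) M)

/-- The small-step reduction relation `(M | V) ⇝ (M' | V')`. In the rule for `while`, the variable
`u` bound by `if b then {…}` is any variable not occurring in the remaining assignment `V`. -/
inductive Step : Config Var 𝒜 → Config Var 𝒜 → Prop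
  | newUnit {V V' : Assign Var 𝒜} {u : Var} (e : Extends V u .star V') :
      Step ⟨.newUnit u, V⟩ ⟨.skip, V'⟩
  | discard {V V' : Assign Var 𝒜} {x : Var} {v : Val 𝒜} (e : Extends V x v V') :
      Step ⟨.discard x, V'⟩ ⟨.skip, V⟩
  | skipSeq {P : Term Var 𝒜} {V : Assign Var 𝒜} : Step ⟨.seq .skip P, V⟩ ⟨P, V⟩
  | seq {P P' Q : Term Var 𝒜} {V V' : Assign Var 𝒜} (h : Step ⟨P, V⟩ ⟨P', V'⟩) :
      Step ⟨.seq P Q, V⟩ ⟨.seq P' Q, V'⟩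
  | whileDo {M : Term Var 𝒜} {V V' : Assign Var 𝒜} {b u : Var} {v : Val 𝒜}
      (e : Extends V b v V') (hu : ∀ p ∈ V.entries, p.1 ≠ u) :
      Step ⟨.whileDo b M, V'⟩ ⟨.ifThen b u (.seq M (.whileDo b M)), V'⟩
  | left {V V₁ V₂ : Assign Var 𝒜} {x y : Var} {A B : Ty 𝒜 0} {v : Val 𝒜}
      (e₁ : Extends V x v V₁) (e₂ : Extends V y (.left A B v) V₂) :
      Step ⟨.left y A B x, V₁⟩ ⟨.skip, V₂⟩
  | right {V V₁ V₂ : Assign Var 𝒜} {x y : Var} {A B : Ty 𝒜 0} {v : Val 𝒜}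
      (e₁ : Extends V x v V₁) (e₂ : Extends V y (.right A B v) V₂) :
      Step ⟨.right y A B x, V₁⟩ ⟨.skip, V₂⟩
  | caseLeft {V V' V₁ : Assign Var 𝒜} {y x₁ x₂ : Var} {M₁ M₂ : Term Var 𝒜} {A B : Ty 𝒜 0}
      {v : Val 𝒜} (e : Extends V y (.left A B v) V') (e₁ : Extends V x₁ v V₁) :
      Step ⟨.caseOf y x₁ M₁ x₂ M₂, V'⟩ ⟨M₁, V₁⟩
  | caseRight {V V' V₂ : Assign Var 𝒜} {y x₁ x₂ : Var} {M₁ M₂ : Term Var 𝒜} {A B : Ty 𝒜 0}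
      {v : Val 𝒜} (e : Extends V y (.right A B v) V') (e₂ : Extends V x₂ v V₂) :
      Step ⟨.caseOf y x₁ M₁ x₂ M₂, V'⟩ ⟨M₂, V₂⟩
  | pair {V V₁ V₂ V' : Assign Var 𝒜} {x x₁ x₂ : Var} {v₁ v₂ : Val 𝒜}
      (e₁ : Extends V x₁ v₁ V₁) (e₂ : Extends V₁ x₂ v₂ V₂) (e : Extends V x (.pair v₁ v₂) V') :
      Step ⟨.pair x x₁ x₂, V₂⟩ ⟨.skip, V'⟩
  | unpair {V V₁ V₂ V' : Assign Var 𝒜} {x x₁ x₂ : Var} {v₁ v₂ : Val 𝒜}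
      (e : Extends V x (.pair v₁ v₂) V') (e₁ : Extends V x₁ v₁ V₁) (e₂ : Extends V₁ x₂ v₂ V₂) :
      Step ⟨.unpair x₁ x₂ x, V'⟩ ⟨.skip, V₂⟩
  | fold {V V₁ V₂ : Assign Var 𝒜} {x y : Var} {A : Ty 𝒜 1} {v : Val 𝒜}
      (e₁ : Extends V x v V₁) (e₂ : Extends V y (.fold A v) V₂) :
      Step ⟨.fold y A x, V₁⟩ ⟨.skip, V₂⟩
  | unfold {V V₁ V₂ : Assign Var 𝒜} {x y : Var} {A : Ty 𝒜 1} {v : Val 𝒜}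
      (e₁ : Extends V x (.fold A v) V₁) (e₂ : Extends V y v V₂) :
      Step ⟨.unfold y x, V₁⟩ ⟨.skip, V₂⟩

/-! ### Interpretation of terms and configurations -/

universe v u

variable (M : Model.{w, v, u} 𝒜)

/-- The object `⟦Γ⟧ = (⋯((I ⊗ ⟦A₁⟧) ⊗ ⟦A₂⟧) ⊗ ⋯) ⊗ ⟦Aₙ⟧` for the entries of a context
`Γ = x₁ : A₁, …, xₙ : Aₙ` with `x₁ < ⋯ < xₙ`. -/
noncomputable def entriesObj : List (Var × Ty 𝒜 0) → M.C
  | [] => 𝟙_ M.C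
  | p :: l => entriesObj l ⊗ p.2.obj M

/-- The object `⟦Γ⟧`. -/
noncomputable abbrev Ctx.obj (Γ : Ctx Var 𝒜) : M.C := entriesObj M Γ.entries

/-- The canonical isomorphism `⟦Γ, x : A⟧ ≅ ⟦Γ⟧ ⊗ ⟦A⟧` which moves the factor of `x` to the end. -/
noncomputable def Insertion.iso {x : Var} {A : Ty 𝒜 0} : ∀ {l l' : List (Var × Ty 𝒜 0)},
    Insertion x A l l' → (entriesObj M l' ≅ entriesObj M l ⊗ A.obj M)
  | _, _, .here _ => Iso.refl _
  | _, _, .there (l := l) p i =>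
      whiskerRightIso (Insertion.iso i) (p.2.obj M) ≪≫
        α_ (entriesObj M l) (A.obj M) (p.2.obj M) ≪≫
        whiskerLeftIso (entriesObj M l) (β_ (A.obj M) (p.2.obj M)) ≪≫
        (α_ (entriesObj M l) (p.2.obj M) (A.obj M)).symm

/-- The canonical isomorphism `⟦Γ, x : A⟧ ≅ ⟦Γ⟧ ⊗ ⟦A⟧`. -/
noncomputable def Extends.iso {Γ Γ' : Ctx Var 𝒜} {x : Var} {A : Ty 𝒜 0} (e : Extends Γ x A Γ') :
    Γ'.obj M ≅ Γ.obj M ⊗ A.obj M :=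
  Insertion.iso M e

/-- The distributivity isomorphism `d : X ⊗ (Y + Z) ≅ (X ⊗ Y) + (X ⊗ Z)`. -/
noncomputable def dist (X Y Z : M.C) : X ⊗ (Y ⨿ Z) ≅ (X ⊗ Y) ⨿ (X ⊗ Z) :=
  (leftDistrib X Y Z).symm

/-- The object `bit = I + I`. -/
noncomputable abbrev bitObj : M.C := 𝟙_ M.C ⨿ 𝟙_ M.C

/-- The endofunction `W_f` of `C(X ⊗ bit, X ⊗ bit)`, given by
`W_f(g) = [id ⊗ left, g ∘ f ∘ (id ⊗ right)] ∘ d`. -/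
noncomputable def whileFun {X : M.C} (f g : X ⊗ bitObj M ⟶ X ⊗ bitObj M) :
    X ⊗ bitObj M ⟶ X ⊗ bitObj M :=
  (dist M X (𝟙_ M.C) (𝟙_ M.C)).hom ≫
    coprod.desc (X ◁ coprod.inl) ((X ◁ coprod.inr) ≫ f ≫ g)

/-- `lfp(h) = ⋁ᵢ hⁱ(⊥)`. -/
def lfp {D : Type v} [CompletePartialOrder D] (h : D → D) : D :=
  sSup (Set.range (fun i : ℕ => h^[i] ⊥))

/-- The interpretation `⟦⊢ ⟨Γ⟩ M ⟨Σ⟩⟧ : ⟦Γ⟧ ⟶ ⟦Σ⟧` of terms. -/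
noncomputable def Term.Typed.interp : ∀ {Γ S : Ctx Var 𝒜} {N : Term Var 𝒜},
    Typed Γ N S → (Γ.obj M ⟶ S.obj M)
  | Γ, _, _, .newUnit e => (ρ_ (Γ.obj M)).inv ≫ (Extends.iso M e).inv
  | _, S, _, .discard (A := A) e =>
      (Extends.iso M e).hom ≫ (S.obj M ◁ A.discard M) ≫ (ρ_ (S.obj M)).hom
  | _, _, _, .seq h k => h.interp ≫ k.interp
  | _, _, _, .skip => 𝟙 _
  | _, _, _, .whileDo (Γ := Γ) e h =>
      (Extends.iso M e).hom ≫
        lfp (whileFun M (X := Γ.obj M)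
          ((Extends.iso M e).inv ≫ h.interp ≫ (Extends.iso M e).hom)) ≫
        (Extends.iso M e).inv
  | _, _, _, .left (Γ := Γ) (A := A) (B := B) e₁ e₂ =>
      (Extends.iso M e₁).hom ≫ (Γ.obj M ◁ (coprod.inl : A.obj M ⟶ A.obj M ⨿ B.obj M)) ≫
        (Extends.iso M e₂).inv
  | _, _, _, .right (Γ := Γ) (A := A) (B := B) e₁ e₂ =>
      (Extends.iso M e₁).hom ≫ (Γ.obj M ◁ (coprod.inr : B.obj M ⟶ A.obj M ⨿ B.obj M)) ≫
        (Extends.iso M e₂).inv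
  | _, _, _, .caseOf (Γ := Γ) (A := A) (B := B) e e₁ h₁ e₂ h₂ =>
      (Extends.iso M e).hom ≫ (dist M (Γ.obj M) (A.obj M) (B.obj M)).hom ≫
        coprod.desc ((Extends.iso M e₁).inv ≫ h₁.interp) ((Extends.iso M e₂).inv ≫ h₂.interp)
  | _, _, _, .pair (Γ := Γ) (A := A) (B := B) e₁ e₂ e =>
      (Extends.iso M e₂).hom ≫ ((Extends.iso M e₁).hom ▷ B.obj M) ≫
        (α_ (Γ.obj M) (A.obj M) (B.obj M)).hom ≫ (Extends.iso M e).inv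
  | _, _, _, .unpair (Γ := Γ) (A := A) (B := B) e e₁ e₂ =>
      (Extends.iso M e).hom ≫ (α_ (Γ.obj M) (A.obj M) (B.obj M)).inv ≫
        ((Extends.iso M e₁).inv ▷ B.obj M) ≫ (Extends.iso M e₂).inv
  | _, _, _, .fold (Γ := Γ) (A := A) e₁ e₂ =>
      (Extends.iso M e₁).hom ≫ (Γ.obj M ◁ (A.foldIso M).hom) ≫ (Extends.iso M e₂).inv
  | _, _, _, .unfold (Γ := Γ) (A := A) e₁ e₂ =>
      (Extends.iso M e₁).hom ≫ (Γ.obj M ◁ (A.foldIso M).inv) ≫ (Extends.iso M e₂).inv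

/-- The interpretation `⟦⊢ v : A⟧ : I ⟶ ⟦A⟧` of values. -/
noncomputable def Val.HasTy.interp : ∀ {A : Ty 𝒜 0} {v : Val 𝒜},
    HasTy v A → (𝟙_ M.C ⟶ A.obj M)
  | _, _, .star => 𝟙 (𝟙_ M.C)
  | _, _, .left (A := A) (B := B) h =>
      h.interp ≫ (coprod.inl : A.obj M ⟶ A.obj M ⨿ B.obj M)
  | _, _, .right (A := A) (B := B) h =>
      h.interp ≫ (coprod.inr : B.obj M ⟶ A.obj M ⨿ B.obj M)
  | _, _, .pair h k => (λ_ (𝟙_ M.C)).inv ≫ (h.interp ⊗ₘ k.interp)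
  | _, _, .fold (A := A) h => h.interp ≫ (A.foldIso M).hom

/-- The interpretation `⟦Γ ⊢ V⟧ : I ⟶ ⟦Γ⟧` of value assignments. -/
noncomputable def AssignTyped.interp : ∀ {l : List (Var × Ty 𝒜 0)} {l' : List (Var × Val 𝒜)},
    AssignTyped l l' → (𝟙_ M.C ⟶ entriesObj M l)
  | _, _, .nil => 𝟙 (𝟙_ M.C)
  | _, _, .cons h _ k => (λ_ (𝟙_ M.C)).inv ≫ (h.interp ⊗ₘ k.interp M)

/-- The interpretation `⟦Γ; Σ ⊢ (M | V)⟧ : I ⟶ ⟦Σ⟧` of well-formed configurations. -/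
noncomputable def Config.WellFormed.interp {Γ S : Ctx Var 𝒜} {c : Config Var 𝒜}
    (h : c.WellFormed Γ S) : 𝟙_ M.C ⟶ S.obj M :=
  AssignTyped.interp M h.assign ≫ h.term.interp M

end Language

end AffineLang

/-!
Soundness of the interpretation of an affine language with inductive types in a categorical model.

Typing is syntax-directed: a value determines its type, a value assignment determines its context,
and an input context together with a term determines the output context and the whole derivation
(`Term.Typed.unique`). Hence a configuration has at most one derivation for a given output context
(`Config.WellFormed.unique`), and it suffices to find, for every step, one derivation of the reduct
with the right interpretation (`Step.exists_wellFormed`).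

For this, the interpretation of an assignment `V, x = v` corresponds to `⟦V⟧ ⊗ ⟦v⟧` under the
canonical isomorphism `⟦Γ, x : A⟧ ≅ ⟦Γ⟧ ⊗ ⟦A⟧`, wherever `x` stands in the order of the variables
(`Assign.Typed.exists_extend` and `Assign.Typed.exists_restrict`). Every reduction rule then becomes
an equation between points of tensor products in a monoidal category. Two rules need more:

* `while` is Kleene's fixed point theorem for the Scott-continuous function `whileFun`
  (`lfp_fixed`, `interp_whileDo_eq_ifThen`);
* `discard` needs that every value is discardable, `◇ ∘ ⟦v⟧ = id` (`Val.HasTy.interp_discard`). The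
  case of `fold` rests on `fold` being a morphism of the slice category over `I`, that is, on a
  substitution lemma for the affine interpretation of types (`Ty.affineInterp_subst`). Its case
  `μX.A` holds because the discarding map of an initial algebra depends only on the endofunctor and
  on the induced algebra structure on `I` (`Ty.mu_affineInterp_congr`).
-/

namespace AffineLang

universe x w v u

/-! ### Uniqueness of derivations -/

section Uniqueness

variable {Var : Type x} {𝒜 : Type w}

theorem Insertion.perm {β : Type w} {x : Var} {b : β} {l l' : List (Var × β)}
    (i : Insertion x b l l') : l'.Perm ((x, b) :: l) := by
  induction i with
  | here l => exact .refl _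
  | there p i ih => exact (ih.cons p).trans (.swap _ _ _)

theorem Val.HasTy.unique {A B : Ty 𝒜 0} {v : Val 𝒜} (h : v.HasTy A) (h' : v.HasTy B) :
    A = B ∧ HEq h h' := by
  induction h generalizing B with
  | star => cases h'; exact ⟨rfl, .rfl⟩
  | left h ih => cases h' with | left h' => obtain ⟨-, ⟨⟩⟩ := ih h'; exact ⟨rfl, .rfl⟩
  | right h ih => cases h' with | right h' => obtain ⟨-, ⟨⟩⟩ := ih h'; exact ⟨rfl, .rfl⟩
  | pair h k ih ik =>
    cases h' with
    | pair h' k' =>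
      obtain ⟨rfl, ⟨⟩⟩ := ih h'
      obtain ⟨rfl, ⟨⟩⟩ := ik k'
      exact ⟨rfl, .rfl⟩
  | fold h ih => cases h' with | fold h' => obtain ⟨-, ⟨⟩⟩ := ih h'; exact ⟨rfl, .rfl⟩

theorem AssignTyped.unique {l l₂ : List (Var × Ty 𝒜 0)} {l' : List (Var × Val 𝒜)}
    (h : AssignTyped l l') (h' : AssignTyped l₂ l') : l = l₂ ∧ HEq h h' := by
  induction h generalizing l₂ with
  | nil => cases h'; exact ⟨rfl, .rfl⟩
  | cons h x k ih =>
    cases h' with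
    | cons h' x k' =>
      obtain ⟨rfl, ⟨⟩⟩ := ih h'
      obtain ⟨rfl, ⟨⟩⟩ := k.unique k'
      exact ⟨rfl, .rfl⟩

variable [LinearOrder Var]

/-- In a list with distinct variables, the entry of a given variable can be removed in only one
way. -/
theorem Insertion.eq_source {β : Type w} {x : Var} {b b' : β} {l l₂ l' : List (Var × β)}
    (i : Insertion x b l l') (i' : Insertion x b' l₂ l')
    (hl : l'.Pairwise (fun p q => q.1 < p.1)) : b = b' ∧ l = l₂ ∧ HEq i i' := by
  induction i generalizing l₂ with
  | here l =>
    cases i' with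
    | here => exact ⟨rfl, rfl, .rfl⟩
    | there p i' =>
      exact absurd ((List.pairwise_cons.1 hl).1 _ (i'.perm.mem_iff.2 List.mem_cons_self))
        (lt_irrefl _)
  | there p i ih =>
    cases i' with
    | here =>
      exact absurd ((List.pairwise_cons.1 hl).1 _ (i.perm.mem_iff.2 List.mem_cons_self))
        (lt_irrefl _)
    | there p i' =>
      obtain ⟨rfl, rfl, h⟩ := ih i' (List.pairwise_cons.1 hl).2
      cases h
      exact ⟨rfl, rfl, .rfl⟩

/-- An entry can be inserted into a sorted list in only one way. -/
theorem Insertion.eq_target {β : Type w} {x : Var} {b : β} {l l₁ l₂ : List (Var × β)}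
    (i : Insertion x b l l₁) (i' : Insertion x b l l₂)
    (h₁ : l₁.Pairwise (fun p q => q.1 < p.1)) (h₂ : l₂.Pairwise (fun p q => q.1 < p.1)) :
    l₁ = l₂ :=
  (i.perm.trans i'.perm.symm).eq_of_pairwise
    (fun _ _ _ _ h k => absurd (h.trans k) (lt_irrefl _)) h₁ h₂

theorem Extends.eq_source {β : Type w} {x : Var} {b b' : β} {m m₂ m' : FMap Var β}
    (e : Extends m x b m') (e' : Extends m₂ x b' m') : b = b' ∧ m = m₂ ∧ HEq e e' := by
  obtain ⟨hb, hl, he⟩ := Insertion.eq_source e e' m'.sorted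
  exact ⟨hb, FMap.ext hl, he⟩

theorem Extends.eq_target {β : Type w} {x : Var} {b : β} {m m₁ m₂ : FMap Var β}
    (e : Extends m x b m₁) (e' : Extends m x b m₂) : m₁ = m₂ ∧ HEq e e' := by
  obtain rfl : m₁ = m₂ := FMap.ext (Insertion.eq_target e e' m₁.sorted m₂.sorted)
  exact ⟨rfl, (Extends.eq_source e e').2.2⟩

/-- Every finite map can be extended at a variable outside its domain. -/
theorem Extends.exists_of_fresh {β : Type w} (m : FMap Var β) {x : Var} (b : β)
    (hx : ∀ p ∈ m.entries, p.1 ≠ x) : ∃ m' : FMap Var β, Nonempty (Extends m x b m') := by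
  suffices h : ∀ l : List (Var × β), l.Pairwise (fun p q => q.1 < p.1) → (∀ p ∈ l, p.1 ≠ x) →
      ∃ l' : List (Var × β), l'.Pairwise (fun p q => q.1 < p.1) ∧
        Nonempty (Insertion x b l l') by
    obtain ⟨l', hl', hi⟩ := h m.entries m.sorted hx
    exact ⟨⟨l', hl'⟩, hi⟩
  intro l hl hx
  induction l with
  | nil => exact ⟨[(x, b)], List.pairwise_singleton _ _, ⟨.here _⟩⟩
  | cons p l ih =>
    obtain ⟨hp, hl'⟩ := List.pairwise_cons.1 hl
    rcases lt_or_gt_of_ne (hx p List.mem_cons_self) with h | h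
    · refine ⟨(x, b) :: p :: l, List.pairwise_cons.2 ⟨fun q hq => ?_, hl⟩, ⟨.here _⟩⟩
      rcases List.mem_cons.1 hq with rfl | hq
      · exact h
      · exact (hp q hq).trans h
    · obtain ⟨l', hs, ⟨i⟩⟩ := ih hl' (fun q hq => hx q (List.mem_cons_of_mem _ hq))
      refine ⟨p :: l', List.pairwise_cons.2 ⟨fun q hq => ?_, hs⟩, ⟨.there p i⟩⟩
      rcases List.mem_cons.1 (i.perm.mem_iff.1 hq) with rfl | hq
      · exact h
      · exact hp q hq

/-- The input context and the term determine the output context and the typing derivation. -/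
theorem Term.Typed.unique {Γ S S' : Ctx Var 𝒜} {N : Term Var 𝒜} (h : N.Typed Γ S)
    (h' : N.Typed Γ S') : S = S' ∧ HEq h h' := by
  induction h generalizing S' with
  | newUnit e =>
    cases h' with
    | newUnit e' =>
      obtain ⟨rfl, ⟨⟩⟩ := Extends.eq_target e e'
      exact ⟨rfl, .rfl⟩
  | discard e =>
    cases h' with
    | discard e' =>
      obtain ⟨rfl, rfl, ⟨⟩⟩ := Extends.eq_source e e'
      exact ⟨rfl, .rfl⟩
  | seq h k ih ik =>
    cases h' with
    | seq h' k' =>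
      obtain ⟨rfl, ⟨⟩⟩ := ih h'
      obtain ⟨rfl, ⟨⟩⟩ := ik k'
      exact ⟨rfl, .rfl⟩
  | skip => cases h'; exact ⟨rfl, .rfl⟩
  | whileDo e h ih =>
    cases h' with
    | whileDo e' h' =>
      obtain ⟨-, rfl, ⟨⟩⟩ := Extends.eq_source e e'
      obtain ⟨-, ⟨⟩⟩ := ih h'
      exact ⟨rfl, .rfl⟩
  | left e₁ e₂ =>
    cases h' with
    | left e₁' e₂' =>
      obtain ⟨-, rfl, ⟨⟩⟩ := Extends.eq_source e₁ e₁'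
      obtain ⟨rfl, ⟨⟩⟩ := Extends.eq_target e₂ e₂'
      exact ⟨rfl, .rfl⟩
  | right e₁ e₂ =>
    cases h' with
    | right e₁' e₂' =>
      obtain ⟨-, rfl, ⟨⟩⟩ := Extends.eq_source e₁ e₁'
      obtain ⟨rfl, ⟨⟩⟩ := Extends.eq_target e₂ e₂'
      exact ⟨rfl, .rfl⟩
  | fold e₁ e₂ =>
    cases h' with
    | fold e₁' e₂' =>
      obtain ⟨-, rfl, ⟨⟩⟩ := Extends.eq_source e₁ e₁'
      obtain ⟨rfl, ⟨⟩⟩ := Extends.eq_target e₂ e₂'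
      exact ⟨rfl, .rfl⟩
  | caseOf e e₁ h₁ e₂ h₂ ih₁ ih₂ =>
    cases h' with
    | caseOf e' e₁' h₁' e₂' h₂' =>
      obtain ⟨hs, rfl, he⟩ := Extends.eq_source e e'
      cases hs
      cases he
      obtain ⟨rfl, ⟨⟩⟩ := Extends.eq_target e₁ e₁'
      obtain ⟨rfl, ⟨⟩⟩ := Extends.eq_target e₂ e₂'
      obtain ⟨rfl, ⟨⟩⟩ := ih₁ h₁'
      obtain ⟨-, ⟨⟩⟩ := ih₂ h₂'
      exact ⟨rfl, .rfl⟩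
  | pair e₁ e₂ e =>
    cases h' with
    | pair e₁' e₂' e' =>
      obtain ⟨rfl, rfl, ⟨⟩⟩ := Extends.eq_source e₂ e₂'
      obtain ⟨rfl, rfl, ⟨⟩⟩ := Extends.eq_source e₁ e₁'
      obtain ⟨rfl, ⟨⟩⟩ := Extends.eq_target e e'
      exact ⟨rfl, .rfl⟩
  | unpair e e₁ e₂ =>
    cases h' with
    | unpair e' e₁' e₂' =>
      obtain ⟨hs, rfl, he⟩ := Extends.eq_source e e'
      cases hs
      cases he
      obtain ⟨rfl, ⟨⟩⟩ := Extends.eq_target e₁ e₁'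
      obtain ⟨rfl, ⟨⟩⟩ := Extends.eq_target e₂ e₂'
      exact ⟨rfl, .rfl⟩
  | unfold e₁ e₂ =>
    cases h' with
    | unfold e₁' e₂' =>
      obtain ⟨hs, rfl, he⟩ := Extends.eq_source e₁ e₁'
      cases hs
      cases he
      obtain ⟨rfl, ⟨⟩⟩ := Extends.eq_target e₂ e₂'
      exact ⟨rfl, .rfl⟩

/-- A configuration has at most one input context and, for a given output context, at most one
derivation. -/
theorem Config.WellFormed.unique {Γ Γ' S : Ctx Var 𝒜} {c : Config Var 𝒜}
    (h : c.WellFormed Γ S) (h' : c.WellFormed Γ' S) : Γ = Γ' ∧ HEq h h' := by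
  obtain ⟨t, a⟩ := h
  obtain ⟨t', a'⟩ := h'
  obtain ⟨hl, ha⟩ := AssignTyped.unique a a'
  obtain rfl : Γ = Γ' := FMap.ext hl
  obtain ⟨-, ht⟩ := t.unique t'
  cases ha
  cases ht
  exact ⟨rfl, .rfl⟩

end Uniqueness

/-! ### Points of tensor products -/

section Points

variable {C : Type u} [Category.{v} C] [MonoidalCategory C]

/-- The tensor product `I ≅ I ⊗ I ⟶ X ⊗ Y` of two points `I ⟶ X` and `I ⟶ Y`. -/
def tensorPoint {X Y : C} (f : 𝟙_ C ⟶ X) (g : 𝟙_ C ⟶ Y) : 𝟙_ C ⟶ X ⊗ Y :=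
  (λ_ (𝟙_ C)).inv ≫ (f ⊗ₘ g)

theorem tensorPoint_whiskerLeft {X Y Y' : C} (f : 𝟙_ C ⟶ X) (g : 𝟙_ C ⟶ Y) (k : Y ⟶ Y') :
    tensorPoint f g ≫ (X ◁ k) = tensorPoint f (g ≫ k) := by
  simp [tensorPoint, MonoidalCategory.tensorHom_def]

theorem tensorPoint_whiskerRight {X X' Y : C} (f : 𝟙_ C ⟶ X) (g : 𝟙_ C ⟶ Y) (k : X ⟶ X') :
    tensorPoint f g ≫ (k ▷ Y) = tensorPoint (f ≫ k) g := by
  simp [tensorPoint, MonoidalCategory.tensorHom_def']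

theorem tensorPoint_associator {X Y Z : C} (f : 𝟙_ C ⟶ X) (g : 𝟙_ C ⟶ Y) (h : 𝟙_ C ⟶ Z) :
    tensorPoint (tensorPoint f g) h ≫ (α_ X Y Z).hom = tensorPoint f (tensorPoint g h) := by
  have h₁ : tensorPoint (tensorPoint f g) h =
      ((λ_ (𝟙_ C)).inv ≫ ((λ_ (𝟙_ C)).inv ▷ 𝟙_ C)) ≫ ((f ⊗ₘ g) ⊗ₘ h) := by
    rw [tensorPoint, tensorPoint, Category.assoc, whiskerRight_comp_tensorHom]
  have h₂ : tensorPoint f (tensorPoint g h) =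
      ((λ_ (𝟙_ C)).inv ≫ (𝟙_ C ◁ (λ_ (𝟙_ C)).inv)) ≫ (f ⊗ₘ (g ⊗ₘ h)) := by
    rw [tensorPoint, tensorPoint, Category.assoc, whiskerLeft_comp_tensorHom]
  rw [h₁, h₂, Category.assoc, associator_naturality, ← Category.assoc]
  congr 1
  monoidal

theorem tensorPoint_braiding [SymmetricCategory C] {X Y : C} (f : 𝟙_ C ⟶ X) (g : 𝟙_ C ⟶ Y) :
    tensorPoint f g ≫ (β_ X Y).hom = tensorPoint g f := by
  simp [tensorPoint, BraidedCategory.braiding_naturality, ← unitors_equal]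

theorem tensorPoint_id_rightUnitor {X : C} (f : 𝟙_ C ⟶ X) :
    tensorPoint f (𝟙 (𝟙_ C)) ≫ (ρ_ X).hom = f := by
  simp [tensorPoint, ← unitors_equal]

end Points

/-! ### Loops -/

section Loops

variable {𝒜 : Type w} (M : Model.{w, v, u} 𝒜)

/-- Kleene's fixed point theorem. -/
theorem lfp_fixed {D : Type v} [CompletePartialOrder D] {h : D → D} (hh : ScottContinuous h) :
    h (lfp h) = lfp h := by
  have hchain : ∀ i : ℕ, h^[i] ⊥ ≤ h^[i + 1] ⊥ := fun i => by
    rw [Function.iterate_succ_apply]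
    exact hh.monotone.iterate i bot_le
  have hmono : Monotone (fun i : ℕ => h^[i] ⊥) := monotone_nat_of_le_succ hchain
  have hdir : DirectedOn (· ≤ ·) (Set.range (fun i : ℕ => h^[i] ⊥)) :=
    (directed_of_isDirected_le hmono).directedOn_range
  have hlub : IsLUB (Set.range (fun i : ℕ => h^[i] ⊥)) (lfp h) := hdir.isLUB_sSup
  -- `h (lfp h)` is the supremum of the shifted chain `hⁱ⁺¹(⊥)`, and so is `lfp h`.
  refine (hh (Set.range_nonempty _) hdir hlub).unique ⟨?_, ?_⟩
  · rintro _ ⟨_, ⟨i, rfl⟩, rfl⟩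
    refine hlub.1 ⟨i + 1, ?_⟩
    exact Function.iterate_succ_apply' h i ⊥
  · intro b hb
    refine hlub.2 ?_
    rintro _ ⟨i, rfl⟩
    exact (hchain i).trans (hb ⟨_, ⟨i, rfl⟩, (Function.iterate_succ_apply' h i ⊥).symm⟩)

/-- The function `W_f` is composed of composition and copairing, which are Scott-continuous in a
model. -/
theorem whileFun_scottContinuous {X : M.C} (f : X ⊗ bitObj M ⟶ X ⊗ bitObj M) :
    ScottContinuous (whileFun M f) := by
  have h₁ := (((ScottContinuous.const f).prodMk ScottContinuous.id).comp
    (M.comp_continuous _ _ (X ⊗ bitObj M)))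
  have h₂ := ((ScottContinuous.const (X ◁ (coprod.inr : 𝟙_ M.C ⟶ bitObj M))).prodMk h₁).comp
    (M.comp_continuous _ _ _)
  have h₃ := ((ScottContinuous.const (X ◁ (coprod.inl : 𝟙_ M.C ⟶ bitObj M))).prodMk h₂).comp
    (M.coprod_continuous _ _ _)
  exact ((ScottContinuous.const (dist M X (𝟙_ M.C) (𝟙_ M.C)).hom).prodMk h₃).comp
    (M.comp_continuous _ _ _)

end Loops

/-! ### Discarding maps under substitution -/

section Discard

variable {𝒜 : Type w} (M : Model.{w, v, u} 𝒜)

theorem power_ext {C : Type u} [Category.{v} C] : ∀ {n : ℕ} {P Q : Power C n},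
    (∀ i, (proj (C := C) i).obj P = (proj i).obj Q) → P = Q
  | 0, _, _, _ => rfl
  | _ + 1, _, _, h => Prod.ext (power_ext fun i => h i.succ) (h 0)

/-- A tuple of functors is determined on objects by its components. -/
theorem tuple_obj_eq {C : Type u} [Category.{v} C] {P : Type u} [Category.{v} P] {n : ℕ}
    {F : Fin n → (P ⥤ C)} {X : P} {Z : Power C n} (h : ∀ i, (F i).obj X = (proj i).obj Z) :
    (tuple F).obj X = Z :=
  power_ext fun i => (congrArg (fun G => G.obj X) (tuple_comp_proj F i)).trans (h i)

theorem curry_prod_id_obj {A' A B : Type*} [Category A'] [Category A] [Category B] (F : A' ⥤ A)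
    (T : A × B ⥤ B) (X : A') :
    (Functor.curry.obj (F.prod (𝟭 B) ⋙ T)).obj X = (Functor.curry.obj T).obj (F.obj X) :=
  CategoryTheory.Functor.ext (fun _ => rfl) (fun _ _ _ => by simp)

namespace Ty

/-- The object `(⟦μX.A⟧, ◇)` of the slice category depends only on the endofunctor whose initial
algebra is `⟦μX.A⟧`, and on the algebra structure on `I` which the affine interpretation of `A`
provides by its value at `(I, id)`. -/
theorem mu_affineInterp_congr {m n : ℕ} {A : Ty 𝒜 (m + 1)} {B : Ty 𝒜 (n + 1)}
    {X : Power (Over (𝟙_ M.C)) m} {Z : Power (Over (𝟙_ M.C)) n}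
    (hF : (Functor.curry.obj (A.interp M).1 : Power M.C m ⥤ M.C ⥤ M.C).obj
        ((powerMap (Over.forget (𝟙_ M.C)) m).obj X) =
      (Functor.curry.obj (B.interp M).1 : Power M.C n ⥤ M.C ⥤ M.C).obj
        ((powerMap (Over.forget (𝟙_ M.C)) n).obj Z))
    (h : (A.affineInterp M).obj (X, Over.mk (𝟙 (𝟙_ M.C))) =
      (B.affineInterp M).obj (Z, Over.mk (𝟙 (𝟙_ M.C)))) :
    ((mu A).affineInterp M).obj X = ((mu B).affineInterp M).obj Z := by
  have aux : ∀ {F G : M.C ⥤ M.C} (hF : OmegaCocontinuous F) (hG : OmegaCocontinuous G)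
      (b : F.obj (𝟙_ M.C) ⟶ 𝟙_ M.C) (c : G.obj (𝟙_ M.C) ⟶ 𝟙_ M.C), F = G →
      Over.mk b = Over.mk c → Over.mk (cata hF b) = Over.mk (cata hG c) := by
    rintro F _ hF hG b c rfl h
    obtain rfl : b = c := by
      have : HEq (Over.mk b).hom (Over.mk c).hom := by rw [h]
      exact eq_of_heq this
    rfl
  exact aux (curry_obj_cocontinuous (A := Power M.C m) _ (A.interp M).2 _)
    (curry_obj_cocontinuous (A := Power M.C n) _ (B.interp M).2 _) _ _ hF h

/-- The affine interpretation commutes with renaming. The environments `X` and `Z` are only required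
to correspond at every variable, so that `Z` need not be written as a tuple. -/
theorem affineInterp_rename : ∀ {n m : ℕ} (A : Ty 𝒜 n) (ρ : Fin n → Fin m)
    {X : Power (Over (𝟙_ M.C)) m} {Z : Power (Over (𝟙_ M.C)) n},
    (∀ i, ((var (ρ i) : Ty 𝒜 m).affineInterp M).obj X = ((var i : Ty 𝒜 n).affineInterp M).obj Z) →
      ((A.rename ρ).affineInterp M).obj X = (A.affineInterp M).obj Z
  | _, _, var i, _, _, _, h => h i
  | _, _, unit, _, _, _, _ => rfl
  | _, _, atom _, _, _, _, _ => rfl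
  | _, _, sum A B, ρ, _, _, h =>
      congrArg₂ (fun P Q => (sliceCoprod M (𝟙_ M.C)).obj (P, Q))
        (affineInterp_rename A ρ h) (affineInterp_rename B ρ h)
  | _, _, tensor A B, ρ, _, _, h =>
      congrArg₂ (fun P Q => (sliceTensor M).obj (P, Q))
        (affineInterp_rename A ρ h) (affineInterp_rename B ρ h)
  | n, m, mu A, ρ, X, Z, h => by
      refine mu_affineInterp_congr M ?_ (affineInterp_rename A (liftRen ρ) (fun i => ?_))
      · rw [interp_rename, tuple_liftRen]
        refine (curry_prod_id_obj (A := Power M.C n) _ _ _).trans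
          (congrArg (Functor.curry.obj (A.interp M).1 : Power M.C n ⥤ M.C ⥤ M.C).obj ?_)
        exact tuple_obj_eq fun i => congrArg (fun Y : Over (𝟙_ M.C) => Y.left) (h i)
      · refine Fin.cases rfl (fun i => ?_) i
        exact h i

/-- The substitution lemma for the affine interpretation: substituting for the variables of `A`
amounts to interpreting `A` in the environment of the interpretations of the substituted types. -/
theorem affineInterp_subst : ∀ {n m : ℕ} (A : Ty 𝒜 n) (σ : Fin n → Ty 𝒜 m)
    {X : Power (Over (𝟙_ M.C)) m} {Z : Power (Over (𝟙_ M.C)) n},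
    (∀ i, ((σ i).affineInterp M).obj X = ((var i : Ty 𝒜 n).affineInterp M).obj Z) →
      ((A.subst σ).affineInterp M).obj X = (A.affineInterp M).obj Z
  | _, _, var i, _, _, _, h => h i
  | _, _, unit, _, _, _, _ => rfl
  | _, _, atom _, _, _, _, _ => rfl
  | _, _, sum A B, σ, _, _, h =>
      congrArg₂ (fun P Q => (sliceCoprod M (𝟙_ M.C)).obj (P, Q))
        (affineInterp_subst A σ h) (affineInterp_subst B σ h)
  | _, _, tensor A B, σ, _, _, h =>
      congrArg₂ (fun P Q => (sliceTensor M).obj (P, Q))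
        (affineInterp_subst A σ h) (affineInterp_subst B σ h)
  | n, m, mu A, σ, X, Z, h => by
      refine mu_affineInterp_congr M ?_ (affineInterp_subst A (liftSub σ) (fun i => ?_))
      · rw [interp_subst, tuple_liftSub]
        refine (curry_prod_id_obj (A := Power M.C n) _ _ _).trans
          (congrArg (Functor.curry.obj (A.interp M).1 : Power M.C n ⥤ M.C ⥤ M.C).obj ?_)
        exact tuple_obj_eq fun i => congrArg (fun Y : Over (𝟙_ M.C) => Y.left) (h i)
      · refine Fin.cases rfl (fun i => ?_) i
        exact (affineInterp_rename M (σ i) Fin.succ (fun _ => rfl)).trans (h i)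

/-- Folding commutes with the discarding maps, so it is a morphism of the slice category. -/
theorem foldIso_hom_discard (A : Ty 𝒜 1) :
    (A.foldIso M).hom ≫ (mu A).discard M = (A.inst (mu A)).discard M := by
  have h₁ : ((A.inst (mu A)).affineInterp M).obj PUnit.unit =
      (A.affineInterp M).obj (PUnit.unit, ((mu A).affineInterp M).obj PUnit.unit) :=
    affineInterp_subst M A _ (Fin.cases rfl (fun i => i.elim0))
  have h₂ := AffineLift.iso_dagger (Q := Power (Over (𝟙_ M.C)) 0) (A.affineLift M)
    (A.interp M).2 PUnit.unit
  -- Equal objects of the slice have the same structure map, up to the transport which `foldIso`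
  -- contains.
  have h₃ : ∀ {P Q : Over (𝟙_ M.C)} (h : P = Q) (k : P.left = Q.left),
      eqToHom k ≫ Q.hom = P.hom := by
    rintro P _ rfl k
    exact Category.id_comp _
  exact (Category.assoc _ _ _).trans ((congrArg _ h₂).trans
    (h₃ h₁ (congrArg (fun P : Over (𝟙_ M.C) => P.left) h₁)))

end Ty

/-- Values are discardable: they are points in the slice category over `I`. -/
theorem Val.HasTy.interp_discard {A : Ty 𝒜 0} {v : Val 𝒜} (h : v.HasTy A) :
    h.interp M ≫ A.discard M = 𝟙 (𝟙_ M.C) := by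
  induction h with
  | star => exact Category.id_comp _
  | left h ih =>
    exact (Category.assoc _ _ _).trans ((congrArg (h.interp M ≫ ·) (coprod.inl_desc _ _)).trans ih)
  | right h ih =>
    exact (Category.assoc _ _ _).trans ((congrArg (h.interp M ≫ ·) (coprod.inr_desc _ _)).trans ih)
  | pair h k ih ik =>
    have aux : ∀ {X Y : M.C} {f : 𝟙_ M.C ⟶ X} {g : 𝟙_ M.C ⟶ Y} {a : X ⟶ 𝟙_ M.C} {b : Y ⟶ 𝟙_ M.C},
        f ≫ a = 𝟙 _ → g ≫ b = 𝟙 _ →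
        ((λ_ (𝟙_ M.C)).inv ≫ (f ⊗ₘ g)) ≫ (a ⊗ₘ b) ≫ (λ_ (𝟙_ M.C)).hom = 𝟙 _ := by
      intro X Y f g a b ha hb
      rw [Category.assoc, tensorHom_comp_tensorHom_assoc, ha, hb]
      simp
    exact aux ih ik
  | fold h ih =>
    exact (Category.assoc _ _ _).trans
      ((congrArg (h.interp M ≫ ·) (Ty.foldIso_hom_discard M _)).trans ih)

end Discard

/-! ### Extension and restriction of assignments -/

section Assignments

variable {Var : Type x} {𝒜 : Type w} (M : Model.{w, v, u} 𝒜)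

/-- If `f` corresponds to `f₀ ⊗ g` under `i`, then `f ⊗ h` corresponds to `(f₀ ⊗ h) ⊗ g` under the
isomorphism which `i` induces in the definition of `Insertion.iso`. -/
theorem tensorPoint_exchange {C : Type u} [Category.{v} C] [MonoidalCategory C]
    [SymmetricCategory C] {W X Y Z : C} {f : 𝟙_ C ⟶ W} {i : W ⟶ X ⊗ Y} {f₀ : 𝟙_ C ⟶ X}
    {g : 𝟙_ C ⟶ Y} (hf : f ≫ i = tensorPoint f₀ g) (h : 𝟙_ C ⟶ Z) :
    tensorPoint f h ≫ (i ▷ Z) ≫ (α_ X Y Z).hom ≫ (X ◁ (β_ Y Z).hom) ≫ (α_ X Z Y).inv =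
      tensorPoint (tensorPoint f₀ h) g := by
  rw [← Category.assoc, tensorPoint_whiskerRight, hf, ← Category.assoc, tensorPoint_associator,
    ← Category.assoc, tensorPoint_whiskerLeft, tensorPoint_braiding, Iso.comp_inv_eq,
    tensorPoint_associator]

theorem AssignTyped.keys_eq {l : List (Var × Ty 𝒜 0)} {lv : List (Var × Val 𝒜)}
    (h : AssignTyped l lv) : l.map Prod.fst = lv.map Prod.fst := by
  induction h with
  | nil => rfl
  | cons h x k ih => exact congrArg (x :: ·) ih

/-- Extending a context by `x : A` where `⊢ v : A` extends the assignment by `x = v` at the same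
position of the list. -/
theorem AssignTyped.exists_insert {l l' : List (Var × Ty 𝒜 0)} {lv : List (Var × Val 𝒜)}
    {x : Var} {A : Ty 𝒜 0} {v : Val 𝒜} (h : AssignTyped l lv) (k : v.HasTy A)
    (i : Insertion x A l l') :
    ∃ (lv' : List (Var × Val 𝒜)) (_ : Insertion x v lv lv') (h' : AssignTyped l' lv'),
      h'.interp M ≫ (i.iso M).hom = tensorPoint (h.interp M) (k.interp M) := by
  induction i generalizing lv with
  | here l => exact ⟨_, .here _, .cons h x k, Category.comp_id _⟩
  | there p i ih =>
    cases h with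
    | cons h y ky =>
      obtain ⟨lv', j, h', e⟩ := ih h
      refine ⟨_, .there _ j, .cons h' y ky, ?_⟩
      exact tensorPoint_exchange e _

/-- Removing a variable from a context removes the entry at the same position of the assignment. -/
theorem AssignTyped.exists_remove {l l' : List (Var × Ty 𝒜 0)} {lv' : List (Var × Val 𝒜)}
    {x : Var} {A : Ty 𝒜 0} (h' : AssignTyped l' lv') (i : Insertion x A l l') :
    ∃ (lv : List (Var × Val 𝒜)) (v : Val 𝒜) (_ : Insertion x v lv lv') (h : AssignTyped l lv)
      (k : v.HasTy A),
      h'.interp M ≫ (i.iso M).hom = tensorPoint (h.interp M) (k.interp M) := by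
  induction i generalizing lv' with
  | here l =>
    cases h' with
    | cons h x k => exact ⟨_, _, .here _, h, k, Category.comp_id _⟩
  | there p i ih =>
    cases h' with
    | cons h' y ky =>
      obtain ⟨lv, v, j, h, k, e⟩ := ih h'
      refine ⟨_, _, .there _ j, .cons h y ky, k, ?_⟩
      exact tensorPoint_exchange e _

variable [LinearOrder Var]

/-- If `Γ ⊢ V` and `⊢ v : A`, then `Γ, x : A ⊢ V, x = v`, and this assignment is interpreted as the
tensor product of `⟦V⟧` and `⟦v⟧`. -/
theorem Assign.Typed.exists_extend {Γ Γ' : Ctx Var 𝒜} {V V' : Assign Var 𝒜} {x : Var}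
    {A : Ty 𝒜 0} {v : Val 𝒜} (h : V.Typed Γ) (k : v.HasTy A) (e : Extends Γ x A Γ')
    (f : Extends V x v V') :
    ∃ h' : V'.Typed Γ',
      AssignTyped.interp M h' ≫ (Extends.iso M e).hom =
        tensorPoint (AssignTyped.interp M h) (k.interp M) := by
  obtain ⟨lv', j, h', e'⟩ := AssignTyped.exists_insert M h k e
  have hs : lv'.Pairwise (fun p q => q.1 < p.1) := by
    have := Γ'.sorted
    rwa [← List.pairwise_map (f := Prod.fst) (R := fun a b => b < a), h'.keys_eq,
      List.pairwise_map] at this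
  obtain rfl := Insertion.eq_target j f hs V'.sorted
  exact ⟨h', e'⟩

/-- If `Γ, x : A ⊢ V, x = v`, then `Γ ⊢ V` and `⊢ v : A`, and `⟦V, x = v⟧` is the tensor product of
`⟦V⟧` and `⟦v⟧`. -/
theorem Assign.Typed.exists_restrict {Γ Γ' : Ctx Var 𝒜} {V V' : Assign Var 𝒜} {x : Var}
    {A : Ty 𝒜 0} {v : Val 𝒜} (h' : V'.Typed Γ') (e : Extends Γ x A Γ') (f : Extends V x v V') :
    ∃ (h : V.Typed Γ) (k : v.HasTy A),
      AssignTyped.interp M h' ≫ (Extends.iso M e).hom =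
        tensorPoint (AssignTyped.interp M h) (k.interp M) := by
  obtain ⟨lv, v', j, h, k, e'⟩ := AssignTyped.exists_remove M h' e
  obtain ⟨rfl, rfl, -⟩ := Insertion.eq_source j f V'.sorted
  exact ⟨h, k, e'⟩

/-- A variable outside an assignment is outside its context. -/
theorem Assign.Typed.fresh {Γ : Ctx Var 𝒜} {V : Assign Var 𝒜} (h : V.Typed Γ) {u : Var}
    (hu : ∀ p ∈ V.entries, p.1 ≠ u) : ∀ p ∈ Γ.entries, p.1 ≠ u := by
  intro p hp
  have : p.1 ∈ V.entries.map Prod.fst := AssignTyped.keys_eq h ▸ List.mem_map_of_mem hp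
  obtain ⟨q, hq, e⟩ := List.mem_map.1 this
  exact e ▸ hu q hq

end Assignments

/-! ### Soundness -/

section Soundness

variable {Var : Type x} [LinearOrder Var] {𝒜 : Type w} (M : Model.{w, v, u} 𝒜)

/-- Applying a map `m` to the last factor of a context, under arbitrary identifications `e` and `e'`
of the contexts with tensor products. -/
theorem comp_map_eq {C : Type u} [Category.{v} C] [MonoidalCategory C] {G G₁ G₂ A B : C}
    {a : 𝟙_ C ⟶ G₁} {a' : 𝟙_ C ⟶ G₂} {e : G₁ ≅ G ⊗ A} {e' : G₂ ≅ G ⊗ B} {f : 𝟙_ C ⟶ G}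
    {k : 𝟙_ C ⟶ A} {k' : 𝟙_ C ⟶ B} {m : A ⟶ B} (h : a ≫ e.hom = tensorPoint f k)
    (h' : a' ≫ e'.hom = tensorPoint f k') (hm : k ≫ m = k') :
    a ≫ e.hom ≫ (G ◁ m) ≫ e'.inv = a' ≫ 𝟙 G₂ := by
  rw [← Category.assoc, h, ← Category.assoc, tensorPoint_whiskerLeft, hm, ← h']
  simp

/-- The rule of `new unit`, under an arbitrary identification `e` of the larger context with a tensor
product. -/
theorem comp_newUnit_eq {C : Type u} [Category.{v} C] [MonoidalCategory C] {G G' : C}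
    {a : 𝟙_ C ⟶ G} {a' : 𝟙_ C ⟶ G'} {e : G' ≅ G ⊗ 𝟙_ C}
    (h : a' ≫ e.hom = tensorPoint a (𝟙 (𝟙_ C))) : a ≫ (ρ_ G).inv ≫ e.inv = a' ≫ 𝟙 G' := by
  rw [Category.comp_id, ← Category.assoc, Iso.comp_inv_eq, h, Iso.comp_inv_eq,
    tensorPoint_id_rightUnitor]

/-- The rule of `discard`, where `k` is the discarded value and `m` its discarding map. -/
theorem comp_discard_eq {C : Type u} [Category.{v} C] [MonoidalCategory C] {G G' A : C}
    {a : 𝟙_ C ⟶ G'} {a' : 𝟙_ C ⟶ G} {e : G' ≅ G ⊗ A} {k : 𝟙_ C ⟶ A} {m : A ⟶ 𝟙_ C}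
    (h : a ≫ e.hom = tensorPoint a' k) (hm : k ≫ m = 𝟙 (𝟙_ C)) :
    a ≫ e.hom ≫ (G ◁ m) ≫ (ρ_ G).hom = a' ≫ 𝟙 G := by
  rw [← Category.assoc, h, ← Category.assoc, tensorPoint_whiskerLeft, hm,
    tensorPoint_id_rightUnitor, Category.comp_id]

/-- The rule of pairing; pairing is an associator, up to the identifications of the contexts with
tensor products. -/
theorem comp_pair_eq {C : Type u} [Category.{v} C] [MonoidalCategory C] {G G₁ G₂ G' A B : C}
    {a : 𝟙_ C ⟶ G₂} {a₁ : 𝟙_ C ⟶ G₁} {a₀ : 𝟙_ C ⟶ G} {a' : 𝟙_ C ⟶ G'} {e₂ : G₂ ≅ G₁ ⊗ B}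
    {e₁ : G₁ ≅ G ⊗ A} {e : G' ≅ G ⊗ (A ⊗ B)} {k₁ : 𝟙_ C ⟶ A} {k₂ : 𝟙_ C ⟶ B}
    (h₂ : a ≫ e₂.hom = tensorPoint a₁ k₂) (h₁ : a₁ ≫ e₁.hom = tensorPoint a₀ k₁)
    (h : a' ≫ e.hom = tensorPoint a₀ (tensorPoint k₁ k₂)) :
    a ≫ e₂.hom ≫ (e₁.hom ▷ B) ≫ (α_ G A B).hom ≫ e.inv = a' ≫ 𝟙 G' := by
  rw [← Category.assoc, h₂, ← Category.assoc, tensorPoint_whiskerRight, h₁, ← Category.assoc,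
    tensorPoint_associator, ← h]
  simp

/-- The rule of unpairing, which is inverse to pairing. -/
theorem comp_unpair_eq {C : Type u} [Category.{v} C] [MonoidalCategory C] {G G₁ G₂ G' A B : C}
    {a : 𝟙_ C ⟶ G'} {a₁ : 𝟙_ C ⟶ G₁} {a₀ : 𝟙_ C ⟶ G} {a₂ : 𝟙_ C ⟶ G₂} {e₂ : G₂ ≅ G₁ ⊗ B}
    {e₁ : G₁ ≅ G ⊗ A} {e : G' ≅ G ⊗ (A ⊗ B)} {k₁ : 𝟙_ C ⟶ A} {k₂ : 𝟙_ C ⟶ B}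
    (h : a ≫ e.hom = tensorPoint a₀ (tensorPoint k₁ k₂)) (h₁ : a₁ ≫ e₁.hom = tensorPoint a₀ k₁)
    (h₂ : a₂ ≫ e₂.hom = tensorPoint a₁ k₂) :
    a ≫ e.hom ≫ (α_ G A B).inv ≫ (e₁.inv ▷ B) ≫ e₂.inv = a₂ ≫ 𝟙 G₂ := by
  have ha := comp_pair_eq h₂ h₁ h
  rw [Category.comp_id] at ha
  rw [← ha]
  simp

theorem tensorPoint_inl_dist {X Y Z : M.C} (f : 𝟙_ M.C ⟶ X) (k : 𝟙_ M.C ⟶ Y) :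
    tensorPoint f (k ≫ (coprod.inl : Y ⟶ Y ⨿ Z)) ≫ (dist M X Y Z).hom =
      tensorPoint f k ≫ coprod.inl := by
  rw [← tensorPoint_whiskerLeft, Category.assoc]
  exact congrArg (tensorPoint f k ≫ ·) whiskerLeft_coprod_inl_leftDistrib_inv

theorem tensorPoint_inr_dist {X Y Z : M.C} (f : 𝟙_ M.C ⟶ X) (k : 𝟙_ M.C ⟶ Z) :
    tensorPoint f (k ≫ (coprod.inr : Z ⟶ Y ⨿ Z)) ≫ (dist M X Y Z).hom =
      tensorPoint f k ≫ coprod.inr := by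
  rw [← tensorPoint_whiskerLeft, Category.assoc]
  exact congrArg (tensorPoint f k ≫ ·) whiskerLeft_coprod_inr_leftDistrib_inv

/-- The rule of `case` for a value `left k`, with branches `m₁` and `m₂`. -/
theorem comp_case_inl {G G' G₁ G₂ Y Z S : M.C} {a : 𝟙_ M.C ⟶ G'} {a₁ : 𝟙_ M.C ⟶ G₁}
    {e : G' ≅ G ⊗ (Y ⨿ Z)} {e₁ : G₁ ≅ G ⊗ Y} {e₂ : G₂ ≅ G ⊗ Z} {f : 𝟙_ M.C ⟶ G}
    {k : 𝟙_ M.C ⟶ Y} (h : a ≫ e.hom = tensorPoint f (k ≫ coprod.inl))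
    (h₁ : a₁ ≫ e₁.hom = tensorPoint f k) (m₁ : G₁ ⟶ S) (m₂ : G₂ ⟶ S) :
    a ≫ e.hom ≫ (dist M G Y Z).hom ≫ coprod.desc (e₁.inv ≫ m₁) (e₂.inv ≫ m₂) = a₁ ≫ m₁ := by
  rw [← Category.assoc, h, ← Category.assoc, tensorPoint_inl_dist, Category.assoc,
    coprod.inl_desc, ← h₁]
  simp

/-- The rule of `case` for a value `right k`, with branches `m₁` and `m₂`. -/
theorem comp_case_inr {G G' G₁ G₂ Y Z S : M.C} {a : 𝟙_ M.C ⟶ G'} {a₂ : 𝟙_ M.C ⟶ G₂}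
    {e : G' ≅ G ⊗ (Y ⨿ Z)} {e₁ : G₁ ≅ G ⊗ Y} {e₂ : G₂ ≅ G ⊗ Z} {f : 𝟙_ M.C ⟶ G}
    {k : 𝟙_ M.C ⟶ Z} (h : a ≫ e.hom = tensorPoint f (k ≫ coprod.inr))
    (h₂ : a₂ ≫ e₂.hom = tensorPoint f k) (m₁ : G₁ ⟶ S) (m₂ : G₂ ⟶ S) :
    a ≫ e.hom ≫ (dist M G Y Z).hom ≫ coprod.desc (e₁.inv ≫ m₁) (e₂.inv ≫ m₂) = a₂ ≫ m₂ := by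
  rw [← Category.assoc, h, ← Category.assoc, tensorPoint_inr_dist, Category.assoc,
    coprod.inr_desc, ← h₂]
  simp

/-- The fixed point equation of a loop, transported along an identification `e` of the context of
the loop with a tensor product. -/
theorem lfp_whileFun_unfold {X G G₁ : M.C} (e : G ≅ X ⊗ bitObj M) (e₁ : G₁ ≅ X ⊗ 𝟙_ M.C)
    (h : G ⟶ G) :
    e.hom ≫ lfp (whileFun M (e.inv ≫ h ≫ e.hom)) ≫ e.inv =
      e.hom ≫ (dist M X (𝟙_ M.C) (𝟙_ M.C)).hom ≫
        coprod.desc (e₁.inv ≫ e₁.hom ≫ (X ◁ coprod.inl) ≫ e.inv)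
          (e₁.inv ≫ (e₁.hom ≫ (X ◁ coprod.inr) ≫ e.inv) ≫ h ≫
            e.hom ≫ lfp (whileFun M (e.inv ≫ h ≫ e.hom)) ≫ e.inv) := by
  conv_lhs => rw [← lfp_fixed (whileFun_scottContinuous M (e.inv ≫ h ≫ e.hom)), whileFun]
  simp [coprod.desc_comp]

/-- A loop has the same interpretation as its unfolding `if b then {N; while b do N}`. -/
theorem interp_whileDo_eq_ifThen {Γ Γ' Γ₁ : Ctx Var 𝒜} {b u : Var} {N : Term Var 𝒜}
    (e : Extends Γ b .bit Γ') (h : N.Typed Γ' Γ') (e₁ : Extends Γ u .unit Γ₁) :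
    (Term.Typed.whileDo e h).interp M =
      (Term.Typed.caseOf e e₁ (.left e₁ e) e₁
        (.seq (.right e₁ e) (.seq h (.whileDo e h)))).interp M :=
  lfp_whileFun_unfold M (Extends.iso M e) (Extends.iso M e₁) (h.interp M)

/-- Subject reduction, together with the invariance of the interpretation for some derivation of the
reduct. -/
theorem Step.exists_wellFormed {Γ S : Ctx Var 𝒜} {c d : Config Var 𝒜} (hc : c.WellFormed Γ S)
    (hstep : Step c d) :
    ∃ (Γ' : Ctx Var 𝒜) (hd : d.WellFormed Γ' S), hc.interp M = hd.interp M := by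
  induction hstep generalizing Γ S with
  | newUnit f =>
    obtain ⟨t, a⟩ := hc
    cases t with
    | newUnit e =>
      obtain ⟨a', ha⟩ := Assign.Typed.exists_extend M a .star e f
      exact ⟨_, ⟨.skip, a'⟩, comp_newUnit_eq ha⟩
  | discard f =>
    obtain ⟨t, a⟩ := hc
    cases t with
    | discard e =>
      obtain ⟨a', k, ha⟩ := Assign.Typed.exists_restrict M a e f
      exact ⟨_, ⟨.skip, a'⟩, comp_discard_eq ha (k.interp_discard M)⟩
  | skipSeq =>
    obtain ⟨t, a⟩ := hc
    cases t with
    | seq h k =>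
      cases h
      exact ⟨_, ⟨k, a⟩, congrArg (AssignTyped.interp M a ≫ ·) (Category.id_comp _)⟩
  | seq h ih =>
    obtain ⟨t, a⟩ := hc
    cases t with
    | seq t k =>
      obtain ⟨Γ', ⟨t', a'⟩, e⟩ := ih ⟨t, a⟩
      refine ⟨Γ', ⟨.seq t' k, a'⟩, ?_⟩
      exact (Category.assoc _ _ _).symm.trans
        ((congrArg (· ≫ k.interp M) e).trans (Category.assoc _ _ _))
  | whileDo f hu =>
    obtain ⟨t, a⟩ := hc
    cases t with
    | whileDo e h =>
      obtain ⟨a₀, -, -⟩ := Assign.Typed.exists_restrict M a e f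
      -- The bound variable `u` may coincide with `b`, so it is added to the context without `b`.
      obtain ⟨Γ₁, ⟨e₁⟩⟩ := Extends.exists_of_fresh _ Ty.unit (Assign.Typed.fresh a₀ hu)
      exact ⟨_, ⟨.caseOf e e₁ (.left e₁ e) e₁ (.seq (.right e₁ e) (.seq h (.whileDo e h))), a⟩,
        congrArg (AssignTyped.interp M a ≫ ·) (interp_whileDo_eq_ifThen M e h e₁)⟩
  | left f₁ f₂ =>
    obtain ⟨t, a⟩ := hc
    cases t with
    | left e₁ e₂ =>
      obtain ⟨a₀, k, ha⟩ := Assign.Typed.exists_restrict M a e₁ f₁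
      obtain ⟨a', ha'⟩ := Assign.Typed.exists_extend M a₀ (.left k) e₂ f₂
      exact ⟨_, ⟨.skip, a'⟩, comp_map_eq ha ha' rfl⟩
  | right f₁ f₂ =>
    obtain ⟨t, a⟩ := hc
    cases t with
    | right e₁ e₂ =>
      obtain ⟨a₀, k, ha⟩ := Assign.Typed.exists_restrict M a e₁ f₁
      obtain ⟨a', ha'⟩ := Assign.Typed.exists_extend M a₀ (.right k) e₂ f₂
      exact ⟨_, ⟨.skip, a'⟩, comp_map_eq ha ha' rfl⟩
  | caseLeft f f₁ =>
    obtain ⟨t, a⟩ := hc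
    cases t with
    | caseOf e e₁ h₁ e₂ h₂ =>
      obtain ⟨a₀, k, ha⟩ := Assign.Typed.exists_restrict M a e f
      cases k with
      | left k =>
        obtain ⟨a', ha'⟩ := Assign.Typed.exists_extend M a₀ k e₁ f₁
        exact ⟨_, ⟨h₁, a'⟩, comp_case_inl M ha ha' _ _⟩
  | caseRight f f₂ =>
    obtain ⟨t, a⟩ := hc
    cases t with
    | caseOf e e₁ h₁ e₂ h₂ =>
      obtain ⟨a₀, k, ha⟩ := Assign.Typed.exists_restrict M a e f
      cases k with
      | right k =>
        obtain ⟨a', ha'⟩ := Assign.Typed.exists_extend M a₀ k e₂ f₂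
        exact ⟨_, ⟨h₂, a'⟩, comp_case_inr M ha ha' _ _⟩
  | pair f₁ f₂ f =>
    obtain ⟨t, a⟩ := hc
    cases t with
    | pair e₁ e₂ e =>
      obtain ⟨a₁, k₂, h₂⟩ := Assign.Typed.exists_restrict M a e₂ f₂
      obtain ⟨a₀, k₁, h₁⟩ := Assign.Typed.exists_restrict M a₁ e₁ f₁
      obtain ⟨a', h'⟩ := Assign.Typed.exists_extend M a₀ (.pair k₁ k₂) e f
      exact ⟨_, ⟨.skip, a'⟩, comp_pair_eq h₂ h₁ h'⟩
  | unpair f f₁ f₂ =>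
    obtain ⟨t, a⟩ := hc
    cases t with
    | unpair e e₁ e₂ =>
      obtain ⟨a₀, k, h⟩ := Assign.Typed.exists_restrict M a e f
      cases k with
      | pair k₁ k₂ =>
        obtain ⟨a₁, h₁⟩ := Assign.Typed.exists_extend M a₀ k₁ e₁ f₁
        obtain ⟨a₂, h₂⟩ := Assign.Typed.exists_extend M a₁ k₂ e₂ f₂
        exact ⟨_, ⟨.skip, a₂⟩, comp_unpair_eq h h₁ h₂⟩
  | fold f₁ f₂ =>
    obtain ⟨t, a⟩ := hc
    cases t with
    | fold e₁ e₂ =>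
      obtain ⟨a₀, k, ha⟩ := Assign.Typed.exists_restrict M a e₁ f₁
      obtain ⟨a', ha'⟩ := Assign.Typed.exists_extend M a₀ (.fold k) e₂ f₂
      exact ⟨_, ⟨.skip, a'⟩, comp_map_eq ha ha' rfl⟩
  | unfold f₁ f₂ =>
    obtain ⟨t, a⟩ := hc
    cases t with
    | unfold e₁ e₂ =>
      obtain ⟨a₀, k, ha⟩ := Assign.Typed.exists_restrict M a e₁ f₁
      cases k with
      | fold k =>
        obtain ⟨a', ha'⟩ := Assign.Typed.exists_extend M a₀ k e₂ f₂
        exact ⟨_, ⟨.skip, a'⟩, comp_map_eq ha ha'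
          ((Category.assoc _ _ _).trans (by rw [Iso.hom_inv_id, Category.comp_id]))⟩

end Soundness

end AffineLang

theorem mainTheorem2 {Var : Type*} [LinearOrder Var] {𝒜 : Type*}
    (M : AffineLang.Model 𝒜) {Γ S : AffineLang.Ctx Var 𝒜} {c d : AffineLang.Config Var 𝒜}
    (hc : c.WellFormed Γ S) (hstep : AffineLang.Step c d) :
    (∃ Γ' : AffineLang.Ctx Var 𝒜, Nonempty (d.WellFormed Γ' S)) ∧
      ∀ (Γ' : AffineLang.Ctx Var 𝒜) (hd : d.WellFormed Γ' S), hc.interp M = hd.interp M := by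
  obtain ⟨Γ₁, hd₁, e⟩ := hstep.exists_wellFormed M hc
  refine ⟨⟨Γ₁, ⟨hd₁⟩⟩, fun Γ' hd => e.trans ?_⟩
  obtain ⟨rfl, ⟨⟩⟩ := hd₁.unique hd
  rfl
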